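/- Let $N\ge 0$ be an integer. Let $X$ be the space of vectors $x=(x[0],\dots,x[N])\in\mathbb C^{N+1}$ with $x[0]\ne0$ and $x[N]\ne0$, modulo multiplication by complex numbers of modulus one, with the quotient topology. Multiplying $x$ by $\overline{x[0]}/|x[0]|$ gives a unique representative with $x[0]>0$; the real and imaginary parts of its entries embed $X$ as a semi-algebraic subset of $\mathbb R^{2N+2}$, and hence $X\times X$ in $\mathbb R^{4N+4}$. Topological terms refer to the classical topology unless the Zariski topology is mentioned; the Zariski topology on a subset of $\mathbb R^M$ is the one whose closed sets are the intersections with real algebraic sets. For $x\in X$ put $\hat x(\omega)=\sum_{n=0}^N x[n]\omega^n$ (defined up to a factor of modulus one) and $\dot x[n]=\overline{x[N-n]}$, and let $I\subset X\times X$ be the set of pairs $(x,x')$ with $|\hat x(\omega)|^2=|\hat x'(\omega)|^2$ for all $|\omega|=1$. We say that $x'$ is obtained from $x$ by a trivial ambiguity if $x'=x$ or $x'=\dot x$ in $X$. For $0\le k\le N$ let $I_k\subset I$ be the set of those $(x,x')\in I$ for which the roots of $\hat x$, counted with multiplicity, can be listed as $\beta_1,\dots,\beta_N$ in such a way that, for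 some $S\subset\{1,\dots,N\}$ with $|S|=k$, the roots of $\hat x'$ are the numbers $\overline{\beta_i}^{-1}$ for $i\in S$ and $\beta_i$ for $i\notin S$. A finite cover is a continuous, open and closed map with finite non-empty fibres between connected, locally connected Hausdorff spaces; the degree of a map is the supremum of the cardinalities of its fibres. Two semi-algebraic sets are isomorphic if there is a homeomorphism between them whose graph is semi-algebraic. Theorem. (i) $I$ is a real algebraic subset of $X\times X$, that is, closed in the Zariski topology. It is the union of $I_0,\dots,I_N$; each $I_k$ is closed, connected, and irreducible (in the Zariski topology); the Zariski closures of $I_0,\dots,I_N$ in $I$ are pairwise distinct and are exactly the irreducible components of $I$. (ii) For $0\le k\le N$ the first projection $I_k\to X$ is a finite cover of degree $\binom Nk$. (iii) The first projection $I\to X$ is a finite cover of degree $\sum_{k=0}^N\binom Nk=2^N$, and $I_0$ and $I_N$ are isomorphic to $X$ as semi-algebraic sets. (iv) The map $(x,x')\mapsto(x,\dot x')$ is a continuous involution of $X\times X$, it maps $I$ into itself, and it maps $I_k$ onto $I_{N-k}$ for $0\le k\le N$. (v) If $(x,x')\in I_k\smallsetminus(I_0\cup I_N)$ for some $0\le k\le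 N$, then $x'$ is not obtained from $x$ by a trivial ambiguity. Moreover, if $0<k<N$, then a generic pair in $I_k$ is not related by a trivial ambiguity: there is a Zariski closed $Z\subset X\times X$ with $I_k\not\subset Z$ such that no pair $(x,x')\in I_k\smallsetminus Z$ is related by a trivial ambiguity. -/

import Mathlib

open Polynomial Topology ComplexConjugate

noncomputable section

/-! ## Real algebraic and semi-algebraic geometry

A set `A` is regarded as a subset of a real coordinate space through a map
`c : A → (ι → ℝ)` giving the coordinates of its points. -/

/-- The Zariski topology on `A`: the closed sets are the zero sets in `A` of families of real
polynomials in the coordinates. -/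
abbrev zariskiTopology {A ι : Type} (c : A → ι → ℝ) : TopologicalSpace A :=
  TopologicalSpace.ofClosed
    {Z | ∃ F : Set (MvPolynomial ι ℝ), Z = {a | ∀ f ∈ F, MvPolynomial.eval (c a) f = 0}}
    ⟨{1}, by ext a; simp⟩
    (by
      intro T hT
      refine ⟨{f | ∃ Z ∈ T, ∀ a ∈ Z, MvPolynomial.eval (c a) f = 0}, ?_⟩
      ext a
      constructor
      · rintro ha f ⟨Z, hZ, hf⟩
        exact hf a (ha Z hZ)
      · intro ha Z hZ
        obtain ⟨F, hF⟩ := hT hZ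
        rw [hF]
        intro f hf
        refine ha f ⟨Z, hZ, fun b hb => ?_⟩
        rw [hF] at hb
        exact hb f hf)
    (by
      rintro _ ⟨F, rfl⟩ _ ⟨G, rfl⟩
      refine ⟨{h | ∃ f ∈ F, ∃ g ∈ G, h = f * g}, ?_⟩
      ext a
      constructor
      · rintro (ha | ha) _ ⟨f, hf, g, hg, rfl⟩
        · simp [ha f hf]
        · simp [ha g hg]
      · intro ha
        by_contra hcon
        simp only [Set.mem_union, Set.mem_ofPred_eq, not_or, not_forall] at hcon
        obtain ⟨⟨f, hf, hfa⟩, ⟨g, hg, hga⟩⟩ := hcon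
        have h := ha (f * g) ⟨f, hf, g, hg, rfl⟩
        rw [map_mul] at h
        exact (mul_ne_zero hfa hga) h)

/-- A semi-algebraic subset of a real coordinate space: a finite union of sets
`{x | P x = 0 and Q₁ x > 0, …, Q_l x > 0}`. -/
def IsSemialgebraic {ι : Type} (S : Set (ι → ℝ)) : Prop :=
  ∃ T : Set (Set (ι → ℝ)), T.Finite ∧ S = ⋃₀ T ∧
    ∀ B ∈ T, ∃ (P : MvPolynomial ι ℝ) (Q : Finset (MvPolynomial ι ℝ)),
      B = {x | MvPolynomial.eval x P = 0 ∧ ∀ q ∈ Q, 0 < MvPolynomial.eval x q}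

/-- `A` and `B`, embedded by the coordinates `c` and `d`, are isomorphic semi-algebraic sets: both
are semi-algebraic and there is a homeomorphism between them with semi-algebraic graph. (The graph
of the inverse is then semi-algebraic too, being the same set with the coordinates permuted.) -/
def SemialgebraicallyIsomorphic {A B ι κ : Type} [TopologicalSpace A] [TopologicalSpace B]
    (c : A → ι → ℝ) (d : B → κ → ℝ) : Prop :=
  IsSemialgebraic (Set.range c) ∧ IsSemialgebraic (Set.range d) ∧
    ∃ e : A ≃ₜ B, IsSemialgebraic (Set.range fun a => Sum.elim (c a) (d (e a)))

/-! ## Finite covers -/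

/-- A finite (possibly ramified) cover of connected, locally connected Hausdorff spaces: a
continuous map that is open and closed, with finite non-empty fibres. -/
structure IsFiniteCover {E B : Type} [TopologicalSpace E] [TopologicalSpace B]
    (f : E → B) : Prop where
  connected_source : ConnectedSpace E
  connected_target : ConnectedSpace B
  locallyConnected_source : LocallyConnectedSpace E
  locallyConnected_target : LocallyConnectedSpace B
  hausdorff_source : T2Space E
  hausdorff_target : T2Space B
  continuous : Continuous f
  isOpenMap : IsOpenMap f
  isClosedMap : IsClosedMap f
  finite_fiber : ∀ b, (f ⁻¹' {b}).Finite
  nonempty_fiber : ∀ b, (f ⁻¹' {b}).Nonempty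

/-- The degree of a map: the supremum of the cardinalities of its fibres. -/
def coverDegree {E B : Type} (f : E → B) : ℕ∞ := ⨆ b, (f ⁻¹' {b}).encard

/-! ## Signals modulo global phase -/

/-- Signals in `ℂ^(N+1)` of full support, that is, with `x[0] ≠ 0` and `x[N] ≠ 0`. -/
abbrev Signal (N : ℕ) : Type :=
  {x : Fin (N + 1) → ℂ // x 0 ≠ 0 ∧ x (Fin.last N) ≠ 0}

/-- The Fourier transform of a signal, as a polynomial. -/
def fourierPoly {N : ℕ} (x : Signal N) : ℂ[X] :=
  ∑ n : Fin (N + 1), C (x.1 n) * X ^ (n : ℕ)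

/-- The Fourier intensity function on the unit circle. -/
def signalIntensity {N : ℕ} (x : Signal N) (ω : Circle) : ℝ :=
  ‖(fourierPoly x).eval (ω : ℂ)‖ ^ 2

/-- Two signals are equivalent if they differ by a global phase. -/
def globalPhase (N : ℕ) : Setoid (Signal N) where
  r x y := ∃ u : Circle, ∀ n, y.1 n = (u : ℂ) * x.1 n
  iseqv :=
    { refl := fun x => ⟨1, fun n => by simp⟩
      symm := by
        rintro x y ⟨u, hu⟩
        refine ⟨u⁻¹, fun n => ?_⟩
        rw [hu n, ← mul_assoc, ← Circle.coe_mul]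
        simp
      trans := by
        rintro x y z ⟨u, hu⟩ ⟨v, hv⟩
        refine ⟨v * u, fun n => ?_⟩
        rw [hv n, hu n, Circle.coe_mul, mul_assoc] }

/-- The space of signals modulo global phase, with the quotient topology. -/
abbrev SignalClass (N : ℕ) : Type := Quotient (globalPhase N)

/-- The class of a signal. -/
def toClass {N : ℕ} (x : Signal N) : SignalClass N := Quotient.mk (globalPhase N) x

/-- The Fourier intensity function of a signal modulo global phase. -/
def intensity {N : ℕ} : SignalClass N → Circle → ℝ :=
  Quotient.lift signalIntensity (by
    rintro x y ⟨u, hu⟩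
    funext ω
    have h : fourierPoly y = C (u : ℂ) * fourierPoly x := by
      simp only [fourierPoly, Finset.mul_sum]
      refine Finset.sum_congr rfl fun n _ => ?_
      rw [hu n, C_mul, mul_assoc]
    simp only [signalIntensity, h, eval_mul, eval_C, norm_mul, Circle.norm_coe, one_mul])

/-- The representative of a class whose entry at `0` is a positive real number:
`x[n]` is multiplied by the conjugate of `x[0] / |x[0]|`. -/
def normalForm {N : ℕ} : SignalClass N → Fin (N + 1) → ℂ :=
  Quotient.lift (fun x n => conj (x.1 0) / (‖x.1 0‖ : ℂ) * x.1 n) (by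
    rintro x y ⟨u, hu⟩
    funext n
    have h : conj (u : ℂ) * (u : ℂ) = 1 := by
      rw [mul_comm, Complex.mul_conj, Circle.normSq_coe, Complex.ofReal_one]
    simp only [hu, map_mul, norm_mul, Circle.norm_coe, one_mul]
    calc conj (x.1 0) / (‖x.1 0‖ : ℂ) * x.1 n
        = (conj (u : ℂ) * (u : ℂ)) * (conj (x.1 0) / (‖x.1 0‖ : ℂ) * x.1 n) := by
          rw [h, one_mul]
      _ = _ := by ring)

/-- The real coordinates of a signal modulo global phase: the real parts (index `(n, 0)`) and
imaginary parts (index `(n, 1)`) of the entries of its normal form. -/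
def classCoord {N : ℕ} (x : SignalClass N) : Fin (N + 1) × Fin 2 → ℝ :=
  fun i => if i.2 = 0 then (normalForm x i.1).re else (normalForm x i.1).im

/-- The real coordinates of a pair of signals modulo global phase. -/
def pairCoord {N : ℕ} (p : SignalClass N × SignalClass N) :
    (Fin (N + 1) × Fin 2) ⊕ (Fin (N + 1) × Fin 2) → ℝ :=
  Sum.elim (classCoord p.1) (classCoord p.2)

/-- Conjugation and reflection of a signal: `n ↦ conj x[N - n]`. -/
def reflectSignal {N : ℕ} (x : Signal N) : Signal N :=
  ⟨fun n => conj (x.1 n.rev), by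
    constructor
    · simpa using x.2.2
    · simpa using x.2.1⟩

/-- Conjugation and reflection on signals modulo global phase. -/
def reflectClass {N : ℕ} : SignalClass N → SignalClass N :=
  Quotient.lift (fun x => toClass (reflectSignal x)) (by
    rintro x y ⟨u, hu⟩
    refine Quotient.sound ⟨u⁻¹, fun n => ?_⟩
    simp only [reflectSignal, hu, map_mul, Circle.coe_inv_eq_conj])

/-- `y` is obtained from `x` by a trivial ambiguity. (Global phases are already divided out.) -/
def IsTrivialAmbiguity {N : ℕ} (x y : SignalClass N) : Prop := y = x ∨ y = reflectClass x

/-! ## The incidence set -/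

/-- The pairs of signals modulo global phase with the same Fourier intensity function. -/
def incidence (N : ℕ) : Set (SignalClass N × SignalClass N) :=
  {p | intensity p.1 = intensity p.2}

/-- The set `I_k`: the pairs in the incidence set for which the `N` roots of the second Fourier
polynomial arise from those of the first (counted with multiplicity) by replacing `k` of them, `β`,
by `1 / conj β`. -/
def incidenceComponent (N k : ℕ) : Set (SignalClass N × SignalClass N) :=
  {p | p ∈ incidence N ∧
    ∃ (x y : Signal N) (β : Fin N → ℂ) (S : Finset (Fin N)) (a b : ℂ),
      toClass x = p.1 ∧ toClass y = p.2 ∧ S.card = k ∧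
      fourierPoly x = C a * ∏ i, (X - C (β i)) ∧
      fourierPoly y = C b * ∏ i, (X - C (if i ∈ S then (conj (β i))⁻¹ else β i))}

/-- The projection of a subset of `X × X` to the first factor. -/
def firstProj {N : ℕ} (S : Set (SignalClass N × SignalClass N)) : S → SignalClass N :=
  fun p => p.1.1

/-- The map `(x, y) ↦ (x, ẏ)`. -/
def reflectSecond {N : ℕ} (p : SignalClass N × SignalClass N) : SignalClass N × SignalClass N :=
  (p.1, reflectClass p.2)

end

/-!
A signal is determined up to a global phase by the positive value `c` of its normal form at `0` and
the multiset of the inverses `α₁, …, α_N` of its roots: its Fourier polynomial is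
`c ∏ (1 - αᵢ X)`. This gives a map `rootClass` from the space `RootData` of all `(c, α)`, an open
subset of a real vector space, onto the space `X` of signals, whose fibres are the orbits of the
symmetric group (`rootClass_eq_iff`). It is proper, because the inverse roots are bounded in terms
of the coefficients and cannot tend to zero while the top coefficient does not
(`isProperMap_rootClass`), and it is open, being a quotient map by a finite group.

For `|ω| = 1` one has `|1 - ω / conj a| |a| = |1 - a ω|`. Reflecting the roots with index in `S`
in the unit circle and multiplying `c` by `∏_{i ∈ S} |αᵢ|` (`flipRoots S`) therefore preserves the
intensity. Conversely, equality of intensities is an identity between the polynomials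
`c² ∏ (1 - αᵢ X) (X - conj αᵢ)`, so two multisets of roots agree after each is joined with its
reflection; then one arises from the other by reflecting a part of it
(`exists_flipRoots_of_intensity_eq`). Thus the incidence set is the union of the images of the maps
`pairOfRoots S : q ↦ (rootClass q, rootClass (flipRoots S q))`, the piece `I_k` is the union over
`|S| = k`, and each single `S` of this size already gives all of it. Since the first component of
`pairOfRoots S` is the proper open map `rootClass`, the projections are finite covers, and for
inverse roots in general position different `S` give different signals, whence the degrees.

In exponential coordinates on `RootData`, reflection of roots is linear and all coordinates of
`pairOfRoots S` are analytic. As the ring of analytic functions on a vector space has no zero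
divisors, each `I_k` is irreducible for the Zariski topology. That the closures of different pieces
are not contained in each other is seen from common roots: on `I_k` the two Fourier polynomials have
a common divisor of degree `N - k`, and the first one has a common divisor of degree `k` with the
reflection of the second. Both conditions are Zariski closed, as degeneracy conditions of Sylvester
matrices (`isClosed_hasCofactors`), and at a general point of another piece one of the two fails
(`eq_of_incidenceComponent_subset_closure`).

Finally, reflection of all roots is conjugation and reflection of the signal, so `I_0` is the
diagonal, `I_N` is the graph of `reflectClass`, and the pairs related by a trivial ambiguity form
the set `I_0 ∪ I_N`, which is Zariski closed.
-/

/-! ### Multisets and their enumerations -/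

theorem Multiset.exists_map_univ_eq {α : Type*} {N : ℕ} (s : Multiset α) (hs : s.card = N) :
    ∃ γ : Fin N → α, Finset.univ.val.map γ = s := by
  obtain ⟨l, rfl⟩ : ∃ l : List α, (l : Multiset α) = s := Quot.exists_rep s
  obtain rfl : l.length = N := hs
  exact ⟨l.get, by rw [Fin.univ_val_map, List.ofFn_get]⟩

theorem Multiset.exists_perm_of_map_univ_eq {ι α : Type*} [Fintype ι] {f g : ι → α}
    (h : Finset.univ.val.map f = Finset.univ.val.map g) :
    ∃ σ : Equiv.Perm ι, ∀ i, g (σ i) = f i := by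
  classical
  have key : ∀ c, Nonempty ({i // f i = c} ≃ {i // g i = c}) := by
    intro c
    refine Fintype.card_eq.1 ?_
    have := congrArg (Multiset.count c) h
    rw [Multiset.count_map, Multiset.count_map] at this
    rw [Fintype.card_subtype, Fintype.card_subtype, Finset.card_def, Finset.card_def,
      Finset.filter_val, Finset.filter_val]
    simpa only [eq_comm] using this
  exact ⟨Equiv.ofFiberEquiv fun c => (key c).some, fun i => Equiv.ofFiberEquiv_map _ i⟩

/-- If two multisets agree after each is joined with its image under an involution `σ`, then one
arises from the other by applying `σ` to a part of it. -/
theorem Multiset.exists_partial_involution {α : Type*} {σ : α → α} (hσ : Function.Involutive σ)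
    (A B : Multiset α) (h : A + A.map σ = B + B.map σ) :
    ∃ T U, A = T + U ∧ B = T.map σ + U := by
  induction A using Multiset.induction_on generalizing B with
  | empty =>
    refine ⟨0, 0, by simp, ?_⟩
    have : B + B.map σ = 0 := by simpa using h.symm
    simpa using (add_eq_zero.1 this).1
  | cons a A ih =>
    have ha : a ∈ B + B.map σ := by rw [← h]; simp
    rcases Multiset.mem_add.1 ha with hB | hB
    · obtain ⟨B, rfl⟩ := Multiset.exists_cons_of_mem hB
      simp only [Multiset.map_cons, Multiset.cons_add, Multiset.add_cons,
        Multiset.cons_inj_right] at h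
      obtain ⟨T, U, rfl, rfl⟩ := ih B h
      exact ⟨T, a ::ₘ U, by simp, by simp⟩
    · obtain ⟨b, hb, rfl⟩ := Multiset.mem_map.1 hB
      obtain ⟨B, rfl⟩ := Multiset.exists_cons_of_mem hb
      simp only [Multiset.map_cons, Multiset.cons_add, Multiset.add_cons, hσ b] at h
      rw [Multiset.cons_swap] at h
      simp only [Multiset.cons_inj_right] at h
      obtain ⟨T, U, rfl, rfl⟩ := ih B h
      exact ⟨σ b ::ₘ T, U, by simp, by simp [hσ b]⟩

/-! ### Polynomials with given inverse roots -/

/-- The polynomial with constant term one and inverse roots `α`. -/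
noncomputable def invRootPoly {N : ℕ} (α : Fin N → ℂ) : ℂ[X] := ∏ i, (1 - C (α i) * X)

theorem natDegree_invRootPoly_le {N : ℕ} (α : Fin N → ℂ) : (invRootPoly α).natDegree ≤ N := by
  refine (natDegree_prod_le _ _).trans ?_
  refine (Finset.sum_le_card_nsmul _ _ 1 fun i _ => ?_).trans (by simp)
  compute_degree

theorem coeff_zero_invRootPoly {N : ℕ} (α : Fin N → ℂ) : (invRootPoly α).coeff 0 = 1 := by
  simp [invRootPoly, coeff_zero_eq_eval_zero, eval_prod]

theorem coeff_top_invRootPoly {N : ℕ} (α : Fin N → ℂ) :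
    (invRootPoly α).coeff N = ∏ i, (-α i) := by
  have h := coeff_prod_of_natDegree_le (s := Finset.univ) (fun i => 1 - C (α i) * X) 1
    (fun i _ => by compute_degree)
  simp only [Finset.card_univ, Fintype.card_fin, mul_one] at h
  rw [invRootPoly, h]
  simp [coeff_one]

theorem eval_invRootPoly {N : ℕ} (α : Fin N → ℂ) (z : ℂ) :
    (invRootPoly α).eval z = ∏ i, (1 - α i * z) := by
  simp [invRootPoly, eval_prod]

theorem invRootPoly_congr {N : ℕ} {α β : Fin N → ℂ}
    (h : Finset.univ.val.map α = Finset.univ.val.map β) : invRootPoly α = invRootPoly β := by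
  have := congrArg (fun s => (s.map fun a => 1 - C a * X).prod) h
  simpa only [invRootPoly, Multiset.map_map, Finset.prod, Function.comp_def] using this

theorem invRootPoly_eq_prod_X_sub_C {N : ℕ} {α : Fin N → ℂ} (h : ∀ i, α i ≠ 0) :
    invRootPoly α = C (∏ i, -α i) * ∏ i, (X - C (α i)⁻¹) := by
  rw [invRootPoly, map_prod, ← Finset.prod_mul_distrib]
  refine Finset.prod_congr rfl fun i _ => ?_
  rw [mul_sub, ← C_mul, neg_mul, mul_inv_cancel₀ (h i)]
  simp only [map_neg, map_one, neg_mul]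
  ring

theorem roots_prod_X_sub_C_fin {N : ℕ} (β : Fin N → ℂ) :
    (∏ i, (X - C (β i))).roots = Finset.univ.val.map β := by
  have := roots_multiset_prod_X_sub_C (Finset.univ.val.map β)
  rwa [Multiset.map_map] at this

theorem prod_X_sub_C_ne_zero_fin {N : ℕ} (β : Fin N → ℂ) : (∏ i, (X - C (β i))) ≠ 0 :=
  Finset.prod_ne_zero_iff.2 fun i _ => X_sub_C_ne_zero (β i)

theorem map_inv_injective {N : ℕ} {α β : Fin N → ℂ}
    (h : Finset.univ.val.map (fun i => (α i)⁻¹) = Finset.univ.val.map (fun i => (β i)⁻¹)) :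
    Finset.univ.val.map α = Finset.univ.val.map β := by
  have := congrArg (Multiset.map (·⁻¹)) h
  simpa [Multiset.map_map, Function.comp_def] using this

/-- The multiset of inverse roots is determined by the polynomial. -/
theorem map_eq_of_invRootPoly_eq {N : ℕ} {α β : Fin N → ℂ} (hα : ∀ i, α i ≠ 0)
    (hβ : ∀ i, β i ≠ 0) (h : invRootPoly α = invRootPoly β) :
    Finset.univ.val.map α = Finset.univ.val.map β := by
  refine map_inv_injective ?_
  have h1 : (∏ i, -α i) ≠ 0 := Finset.prod_ne_zero_iff.2 fun i _ => neg_ne_zero.2 (hα i)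
  have h2 : (∏ i, -β i) ≠ 0 := Finset.prod_ne_zero_iff.2 fun i _ => neg_ne_zero.2 (hβ i)
  rw [invRootPoly_eq_prod_X_sub_C hα, invRootPoly_eq_prod_X_sub_C hβ] at h
  have := congrArg roots h
  rwa [roots_C_mul _ h1, roots_C_mul _ h2, roots_prod_X_sub_C_fin, roots_prod_X_sub_C_fin] at this

/-! ### Signals from their inverse roots -/

/-- Parameters for signals in normal form: the positive entry at `0` and an enumeration of the
inverses of the roots of the Fourier polynomial. -/
abbrev RootData (N : ℕ) : Type := {q : ℝ × (Fin N → ℂ) // 0 < q.1 ∧ ∀ i, q.2 i ≠ 0}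

/-- The signal in normal form with given value at `0` and given inverse roots. -/
noncomputable def signalOfRoots {N : ℕ} (q : RootData N) : Signal N :=
  ⟨fun n => q.1.1 * (invRootPoly q.1.2).coeff n, by
    have h : (q.1.1 : ℂ) ≠ 0 := by exact_mod_cast q.2.1.ne'
    constructor
    · simpa [coeff_zero_invRootPoly] using q.2.1.ne'
    · simpa [coeff_top_invRootPoly, Finset.prod_eq_zero_iff] using ⟨q.2.1.ne', q.2.2⟩⟩

/-- The class of the signal with given value at `0` and given inverse roots. -/
noncomputable def rootClass {N : ℕ} (q : RootData N) : SignalClass N := toClass (signalOfRoots q)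

theorem fourierPoly_coeff {N : ℕ} (x : Signal N) (n : Fin (N + 1)) :
    (fourierPoly x).coeff n = x.1 n := by
  simp [fourierPoly, coeff_C_mul, coeff_X_pow, Fin.val_inj]

theorem natDegree_fourierPoly_le {N : ℕ} (x : Signal N) : (fourierPoly x).natDegree ≤ N := by
  refine natDegree_sum_le_of_forall_le _ _ fun n _ => (natDegree_C_mul_X_pow_le _ _).trans ?_
  exact Nat.lt_succ_iff.1 n.2

theorem sum_C_coeff_mul_X_pow {N : ℕ} {p : ℂ[X]} (hp : p.natDegree ≤ N) :
    ∑ n : Fin (N + 1), C (p.coeff n) * X ^ (n : ℕ) = p := by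
  rw [Fin.sum_univ_eq_sum_range (fun n => C (p.coeff n) * X ^ n)]
  exact (as_sum_range_C_mul_X_pow' p (Nat.lt_succ_iff.2 hp)).symm

theorem fourierPoly_signalOfRoots {N : ℕ} (q : RootData N) :
    fourierPoly (signalOfRoots q) = C (q.1.1 : ℂ) * invRootPoly q.1.2 := by
  conv_rhs => rw [← sum_C_coeff_mul_X_pow (natDegree_invRootPoly_le q.1.2)]
  simp only [fourierPoly, signalOfRoots, C_mul, mul_assoc, Finset.mul_sum]

theorem normalForm_toClass_of_pos {N : ℕ} {x : Signal N} {r : ℝ} (hr : 0 < r) (h : x.1 0 = r) :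
    normalForm (toClass x) = x.1 := by
  funext n
  change conj (x.1 0) / (‖x.1 0‖ : ℂ) * x.1 n = _
  rw [h, Complex.conj_ofReal, Complex.norm_real, Real.norm_of_nonneg hr.le,
    div_self (Complex.ofReal_ne_zero.2 hr.ne'), one_mul]

theorem signalOfRoots_zero {N : ℕ} (q : RootData N) : (signalOfRoots q).1 0 = q.1.1 := by
  simp [signalOfRoots, coeff_zero_invRootPoly]

theorem normalForm_rootClass {N : ℕ} (q : RootData N) :
    normalForm (rootClass q) = (signalOfRoots q).1 :=
  normalForm_toClass_of_pos q.2.1 (signalOfRoots_zero q)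

/-- A factorisation of the Fourier polynomial exhibits the class of a signal as a value of
`rootClass`. -/
theorem toClass_eq_rootClass {N : ℕ} {x : Signal N} {a : ℂ} {β : Fin N → ℂ}
    (h : fourierPoly x = C a * ∏ i, (X - C (β i))) :
    ∃ q : RootData N, (∀ i, q.1.2 i = (β i)⁻¹) ∧ rootClass q = toClass x := by
  have h0 : x.1 0 = a * ∏ i, (-β i) := by
    rw [← fourierPoly_coeff, h]
    simp [coeff_zero_eq_eval_zero, eval_prod]
  have hβ : ∀ i, β i ≠ 0 := by
    intro i hi
    refine x.2.1 ?_
    rw [h0, Finset.prod_eq_zero (Finset.mem_univ i) (by simp [hi]), mul_zero]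
  have hx : fourierPoly x = C (x.1 0) * invRootPoly fun i => (β i)⁻¹ := by
    rw [invRootPoly_eq_prod_X_sub_C fun i => inv_ne_zero (hβ i), ← mul_assoc, ← C_mul, h0,
      mul_assoc, ← Finset.prod_mul_distrib, h]
    simp [hβ]
  refine ⟨⟨(‖x.1 0‖, fun i => (β i)⁻¹), norm_pos_iff.2 x.2.1, fun i => inv_ne_zero (hβ i)⟩,
    fun i => rfl, Quotient.sound ⟨Circle.exp (x.1 0).arg, fun n => ?_⟩⟩
  rw [← fourierPoly_coeff, hx, coeff_C_mul]
  change _ = _ * ((‖x.1 0‖ : ℂ) * _)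
  rw [← mul_assoc, mul_comm _ (‖x.1 0‖ : ℂ), Circle.coe_exp, Complex.norm_mul_exp_arg_mul_I]

theorem exists_fourierPoly_eq {N : ℕ} (x : Signal N) :
    ∃ (a : ℂ) (β : Fin N → ℂ), fourierPoly x = C a * ∏ i, (X - C (β i)) := by
  have hN : (fourierPoly x).coeff N ≠ 0 := by
    have := fourierPoly_coeff x (Fin.last N)
    rw [Fin.val_last] at this
    rw [this]
    exact x.2.2
  have hd : (fourierPoly x).natDegree = N :=
    le_antisymm (natDegree_fourierPoly_le x) (le_natDegree_of_ne_zero hN)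
  have hs := IsAlgClosed.splits (fourierPoly x)
  obtain ⟨β, hβ⟩ := Multiset.exists_map_univ_eq (N := N) (fourierPoly x).roots
    (by rw [← hs.natDegree_eq_card_roots, hd])
  refine ⟨(fourierPoly x).leadingCoeff, β, ?_⟩
  conv_lhs => rw [hs.eq_prod_roots, ← hβ, Multiset.map_map]
  rfl

theorem rootClass_surjective {N : ℕ} : Function.Surjective (rootClass (N := N)) := by
  intro z
  obtain ⟨x, rfl⟩ := Quotient.exists_rep z
  obtain ⟨a, β, h⟩ := exists_fourierPoly_eq x
  obtain ⟨q, -, hq⟩ := toClass_eq_rootClass h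
  exact ⟨q, hq⟩

theorem rootClass_congr {N : ℕ} {p q : RootData N} (hc : p.1.1 = q.1.1)
    (h : Finset.univ.val.map p.1.2 = Finset.univ.val.map q.1.2) : rootClass p = rootClass q := by
  have : signalOfRoots p = signalOfRoots q :=
    Subtype.ext (by simp only [signalOfRoots, hc, invRootPoly_congr h])
  rw [rootClass, this, rootClass]

theorem eq_of_rootClass_eq {N : ℕ} {p q : RootData N} (h : rootClass p = rootClass q) :
    p.1.1 = q.1.1 ∧ Finset.univ.val.map p.1.2 = Finset.univ.val.map q.1.2 := by
  have h1 : signalOfRoots p = signalOfRoots q :=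
    Subtype.ext (by rw [← normalForm_rootClass, ← normalForm_rootClass, h])
  have h2 := congrArg fourierPoly h1
  rw [fourierPoly_signalOfRoots, fourierPoly_signalOfRoots] at h2
  have h3 : (p.1.1 : ℂ) = q.1.1 := by
    have := congrArg (fun r => r.coeff 0) h2
    simpa [coeff_zero_invRootPoly] using this
  have h4 : (q.1.1 : ℂ) ≠ 0 := by exact_mod_cast q.2.1.ne'
  rw [h3] at h2
  exact ⟨by exact_mod_cast h3, map_eq_of_invRootPoly_eq p.2.2 q.2.2
    (mul_left_cancel₀ (C_ne_zero.2 h4) h2)⟩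

theorem normalForm_injective {N : ℕ} : Function.Injective (normalForm (N := N)) := by
  intro y z h
  obtain ⟨p, rfl⟩ := rootClass_surjective y
  obtain ⟨q, rfl⟩ := rootClass_surjective z
  rw [normalForm_rootClass, normalForm_rootClass] at h
  rw [rootClass, rootClass, Subtype.ext h]

/-- The permutation action on the enumerations of the inverse roots. -/
def permRoots {N : ℕ} (σ : Equiv.Perm (Fin N)) (q : RootData N) : RootData N :=
  ⟨(q.1.1, q.1.2 ∘ σ), q.2.1, fun i => q.2.2 (σ i)⟩

theorem rootClass_permRoots {N : ℕ} (σ : Equiv.Perm (Fin N)) (q : RootData N) :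
    rootClass (permRoots σ q) = rootClass q := by
  refine rootClass_congr rfl ?_
  change Finset.univ.val.map (q.1.2 ∘ σ) = _
  rw [← Multiset.map_map, Multiset.map_univ_val_equiv]

/-- The fibres of `rootClass` are the orbits of the symmetric group. -/
theorem rootClass_eq_iff {N : ℕ} {p q : RootData N} :
    rootClass p = rootClass q ↔ ∃ σ, p = permRoots σ q := by
  constructor
  · intro h
    obtain ⟨hc, hm⟩ := eq_of_rootClass_eq h
    obtain ⟨σ, hσ⟩ := Multiset.exists_perm_of_map_univ_eq hm
    exact ⟨σ, Subtype.ext (Prod.ext hc (funext fun i => (hσ i).symm))⟩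
  · rintro ⟨σ, rfl⟩
    exact rootClass_permRoots σ q

/-! ### Reflection of roots in the unit circle -/

/-- Replace the inverse roots with index in `S` by their reflections in the unit circle. -/
noncomputable def flipVec {N : ℕ} (S : Finset (Fin N)) (α : Fin N → ℂ) : Fin N → ℂ :=
  fun i => if i ∈ S then (conj (α i))⁻¹ else α i

/-- Reflect the roots with index in `S` in the unit circle, and change the value at `0` by the
factor that leaves the Fourier intensity unchanged. -/
noncomputable def flipRoots {N : ℕ} (S : Finset (Fin N)) (q : RootData N) : RootData N :=
  ⟨(q.1.1 * ∏ i ∈ S, ‖q.1.2 i‖, flipVec S q.1.2),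
    mul_pos q.2.1 (Finset.prod_pos fun i _ => norm_pos_iff.2 (q.2.2 i)), fun i => by
      have := q.2.2 i
      by_cases h : i ∈ S <;> simp [flipVec, h, this]⟩

theorem intensity_rootClass {N : ℕ} (q : RootData N) (ω : Circle) :
    intensity (rootClass q) ω = (q.1.1 * ‖(invRootPoly q.1.2).eval (ω : ℂ)‖) ^ 2 := by
  change ‖(fourierPoly (signalOfRoots q)).eval (ω : ℂ)‖ ^ 2 = _
  rw [fourierPoly_signalOfRoots, eval_C_mul, norm_mul, Complex.norm_real,
    Real.norm_of_nonneg q.2.1.le]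

theorem norm_one_sub_inv_conj_mul {a : ℂ} (ha : a ≠ 0) (ω : Circle) :
    ‖1 - (conj a)⁻¹ * (ω : ℂ)‖ * ‖a‖ = ‖1 - a * (ω : ℂ)‖ := by
  have ha' : conj a ≠ 0 := by simpa using ha
  have hω : conj (ω : ℂ) * ω = 1 := by
    rw [mul_comm, Complex.mul_conj, Circle.normSq_coe, Complex.ofReal_one]
  rw [← Complex.norm_conj a, ← norm_mul, sub_mul, one_mul, mul_assoc, mul_comm (ω : ℂ),
    inv_mul_cancel_left₀ ha', ← Complex.norm_conj, map_sub, Complex.conj_conj]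
  calc ‖a - conj (ω : ℂ)‖ = ‖(a - conj (ω : ℂ)) * ω‖ := by rw [norm_mul, Circle.norm_coe, mul_one]
    _ = _ := by rw [sub_mul, hω, norm_sub_rev]

theorem intensity_flipRoots {N : ℕ} (S : Finset (Fin N)) (q : RootData N) :
    intensity (rootClass (flipRoots S q)) = intensity (rootClass q) := by
  funext ω
  rw [intensity_rootClass, intensity_rootClass]
  congr 1
  simp only [flipRoots, eval_invRootPoly, norm_prod]
  rw [mul_assoc]
  congr 1
  rw [← Finset.univ_inter S, ← Finset.prod_ite_mem, ← Finset.prod_mul_distrib]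
  refine Finset.prod_congr rfl fun i _ => ?_
  by_cases h : i ∈ S
  · rw [Finset.univ_inter, if_pos h, flipVec, if_pos h, mul_comm,
      norm_one_sub_inv_conj_mul (q.2.2 i)]
  · rw [Finset.univ_inter, if_neg h, flipVec, if_neg h, one_mul]

theorem infinite_range_circle : (Set.range fun z : Circle => (z : ℂ)).Infinite := by
  have : Infinite (Set.Ioc (-Real.pi) Real.pi) :=
    Set.Ioc.infinite (by linarith [Real.pi_pos])
  have : Infinite Circle := Infinite.of_injective _ Circle.argEquiv.symm.injective
  exact Set.infinite_range_of_injective Circle.coe_injective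

/-- The intensity determines the value at `0` once the inverse roots are known. -/
theorem rootClass_eq_of_intensity_eq {N : ℕ} {p q : RootData N}
    (h : intensity (rootClass p) = intensity (rootClass q))
    (hm : Finset.univ.val.map p.1.2 = Finset.univ.val.map q.1.2) : rootClass p = rootClass q := by
  refine rootClass_congr ?_ hm
  have hne : invRootPoly q.1.2 ≠ 0 := fun h0 => by
    simpa [h0] using coeff_zero_invRootPoly q.1.2
  obtain ⟨_, ⟨ω, rfl⟩, hω⟩ : ∃ z ∈ Set.range fun z : Circle => (z : ℂ),
      (invRootPoly q.1.2).eval z ≠ 0 := by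
    by_contra! hcon
    exact hne (eq_zero_of_infinite_isRoot _ (infinite_range_circle.mono hcon))
  have h1 := congrFun h ω
  rw [intensity_rootClass, intensity_rootClass, invRootPoly_congr hm] at h1
  have h2 := (pow_left_inj₀ (mul_nonneg p.2.1.le (norm_nonneg _))
    (mul_nonneg q.2.1.le (norm_nonneg _)) two_ne_zero).1 h1
  exact mul_right_cancel₀ (norm_ne_zero_iff.2 hω) h2

/-- The polynomial whose values on the unit circle are, up to the factor `ω ^ N`, the squared
absolute values of `invRootPoly α`. -/
theorem prod_norm_sq_mul_pow {N : ℕ} (α : Fin N → ℂ) (ω : Circle) :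
    ((‖(invRootPoly α).eval (ω : ℂ)‖ ^ 2 : ℝ) : ℂ) * (ω : ℂ) ^ N =
      (invRootPoly α * ∏ i, (X - C (conj (α i)))).eval (ω : ℂ) := by
  have hω : conj (ω : ℂ) * ω = 1 := by
    rw [mul_comm, Complex.mul_conj, Circle.normSq_coe, Complex.ofReal_one]
  have hN : (ω : ℂ) ^ N = ∏ _i : Fin N, (ω : ℂ) := by simp
  rw [Complex.ofReal_pow, ← Complex.mul_conj', eval_mul, mul_assoc, hN]
  congr 1
  rw [eval_invRootPoly, map_prod, ← Finset.prod_mul_distrib, eval_prod]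
  refine Finset.prod_congr rfl fun i _ => ?_
  simp only [map_sub, map_one, map_mul, sub_mul, one_mul, mul_assoc, hω, mul_one, eval_sub, eval_X,
    eval_C]

/-- Signals with equal intensity have, up to reflection of some of them, the same roots. -/
theorem exists_flipRoots_of_intensity_eq {N : ℕ} {p q : RootData N}
    (h : intensity (rootClass p) = intensity (rootClass q)) :
    ∃ (r : RootData N) (S : Finset (Fin N)),
      rootClass r = rootClass p ∧ rootClass (flipRoots S r) = rootClass q := by
  have hpoly : C ((p.1.1 : ℂ) ^ 2) * (invRootPoly p.1.2 * ∏ i, (X - C (conj (p.1.2 i)))) =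
      C ((q.1.1 : ℂ) ^ 2) * (invRootPoly q.1.2 * ∏ i, (X - C (conj (q.1.2 i)))) := by
    refine eq_of_infinite_eval_eq _ _ (infinite_range_circle.mono ?_)
    rintro _ ⟨ω, rfl⟩
    have h1 := congrFun h ω
    rw [intensity_rootClass, intensity_rootClass, mul_pow, mul_pow] at h1
    have h2 : ((p.1.1 : ℂ) ^ 2) * ((‖(invRootPoly p.1.2).eval (ω : ℂ)‖ ^ 2 : ℝ) : ℂ) =
        ((q.1.1 : ℂ) ^ 2) * ((‖(invRootPoly q.1.2).eval (ω : ℂ)‖ ^ 2 : ℝ) : ℂ) := by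
      exact_mod_cast h1
    simp only [Set.mem_ofPred_eq]
    rw [eval_C_mul, eval_C_mul, ← prod_norm_sq_mul_pow, ← prod_norm_sq_mul_pow, ← mul_assoc,
      ← mul_assoc, h2]
  -- the roots are those of the signal together with their reflections
  have hroots : ∀ r : RootData N,
      (C ((r.1.1 : ℂ) ^ 2) * (invRootPoly r.1.2 * ∏ i, (X - C (conj (r.1.2 i))))).roots =
        Finset.univ.val.map (fun i => (r.1.2 i)⁻¹) +
          (Finset.univ.val.map (fun i => (r.1.2 i)⁻¹)).map (fun z => conj z⁻¹) := by
    intro r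
    have h1 : (r.1.1 : ℂ) ^ 2 ≠ 0 := pow_ne_zero 2 (by exact_mod_cast r.2.1.ne')
    have h2 : (∏ i, -r.1.2 i) ≠ 0 :=
      Finset.prod_ne_zero_iff.2 fun i _ => neg_ne_zero.2 (r.2.2 i)
    rw [roots_C_mul _ h1, invRootPoly_eq_prod_X_sub_C r.2.2, mul_assoc, roots_C_mul _ h2,
      roots_mul (mul_ne_zero (prod_X_sub_C_ne_zero_fin _) (prod_X_sub_C_ne_zero_fin _)),
      roots_prod_X_sub_C_fin, roots_prod_X_sub_C_fin, Multiset.map_map]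
    simp
  have hinv : Function.Involutive fun z : ℂ => conj z⁻¹ := fun z => by simp
  obtain ⟨T, U, hT, hU⟩ := Multiset.exists_partial_involution hinv _ _
    ((hroots p).symm.trans ((congrArg roots hpoly).trans (hroots q)))
  -- enumerate the roots together with a label saying whether they are reflected
  obtain ⟨γ, hγ⟩ := Multiset.exists_map_univ_eq (N := N)
    (T.map (fun z => (z, true)) + U.map (fun z => (z, false))) (by
      have := congrArg Multiset.card hT
      simpa using this.symm)
  have hγp : Finset.univ.val.map (fun i => (γ i).1) = Finset.univ.val.map fun i => (p.1.2 i)⁻¹ := by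
    have := congrArg (Multiset.map Prod.fst) hγ
    simpa [Multiset.map_map, Function.comp_def, ← hT] using this
  have hγq : Finset.univ.val.map (fun i => if (γ i).2 then conj (γ i).1⁻¹ else (γ i).1) =
      Finset.univ.val.map fun i => (q.1.2 i)⁻¹ := by
    have := congrArg (Multiset.map fun z : ℂ × Bool => if z.2 then conj z.1⁻¹ else z.1) hγ
    rw [hU]
    simpa [-Fin.univ_val_map, Multiset.map_map, Function.comp_def] using this
  have hne : ∀ i, (γ i).1 ≠ 0 := by
    intro i
    have : (γ i).1 ∈ Finset.univ.val.map (fun i => (γ i).1) :=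
      Multiset.mem_map_of_mem _ (Finset.mem_univ i)
    rw [hγp] at this
    obtain ⟨j, -, hj⟩ := Multiset.mem_map.1 this
    rw [← hj]
    exact inv_ne_zero (p.2.2 j)
  let r : RootData N := ⟨(p.1.1, fun i => ((γ i).1)⁻¹), p.2.1, fun i => inv_ne_zero (hne i)⟩
  have hr : rootClass r = rootClass p :=
    rootClass_congr rfl (map_inv_injective (by simpa [r] using hγp))
  refine ⟨r, Finset.univ.filter fun i => (γ i).2 = true, hr,
    rootClass_eq_of_intensity_eq (by rw [intensity_flipRoots, hr, h]) (map_inv_injective ?_)⟩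
  rw [← hγq]
  refine Multiset.map_congr rfl fun i _ => ?_
  by_cases hi : (γ i).2 = true <;> simp [flipRoots, flipVec, r, hi]

/-- The pair of signals with the same intensity given by a choice of roots to be reflected. -/
noncomputable def pairOfRoots {N : ℕ} (S : Finset (Fin N)) (q : RootData N) :
    SignalClass N × SignalClass N :=
  (rootClass q, rootClass (flipRoots S q))

theorem flipRoots_empty {N : ℕ} (q : RootData N) : flipRoots ∅ q = q :=
  Subtype.ext (Prod.ext (by simp [flipRoots]) (by funext i; simp [flipRoots, flipVec]))

theorem flipRoots_univ_flipRoots {N : ℕ} (S : Finset (Fin N)) (q : RootData N) :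
    flipRoots Finset.univ (flipRoots S q) = flipRoots Sᶜ q := by
  refine Subtype.ext (Prod.ext ?_ ?_)
  · simp only [flipRoots]
    rw [mul_assoc, ← Finset.prod_mul_prod_compl S (fun i => ‖flipVec S q.1.2 i‖), ← mul_assoc,
      ← mul_assoc, mul_assoc q.1.1, ← Finset.prod_mul_distrib]
    congr 1
    · rw [Finset.prod_eq_one, mul_one]
      intro i hi
      simp [flipVec, hi, q.2.2 i]
    · refine Finset.prod_congr rfl fun i hi => ?_
      simp [flipVec, Finset.mem_compl.1 hi]
  · funext i
    by_cases h : i ∈ S <;> simp [flipRoots, flipVec, h]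

theorem flipRoots_permRoots {N : ℕ} (S : Finset (Fin N)) (σ : Equiv.Perm (Fin N))
    (q : RootData N) :
    flipRoots S (permRoots σ q) = permRoots σ (flipRoots (S.map σ.toEmbedding) q) := by
  refine Subtype.ext (Prod.ext ?_ ?_)
  · simp [flipRoots, permRoots]
  · funext i
    simp [flipRoots, permRoots, flipVec]

theorem rootClass_flipRoots_permRoots {N : ℕ} (S : Finset (Fin N)) (σ : Equiv.Perm (Fin N))
    (q : RootData N) :
    rootClass (flipRoots S (permRoots σ q)) = rootClass (flipRoots (S.map σ.toEmbedding) q) := by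
  rw [flipRoots_permRoots, rootClass_permRoots]

/-! ### The incidence set in terms of roots -/

theorem pairOfRoots_mem_incidence {N : ℕ} (S : Finset (Fin N)) (q : RootData N) :
    pairOfRoots S q ∈ incidence N :=
  (intensity_flipRoots S q).symm

theorem mem_incidence_iff {N : ℕ} {z : SignalClass N × SignalClass N} :
    z ∈ incidence N ↔ ∃ S q, pairOfRoots S q = z := by
  constructor
  · intro h
    obtain ⟨x, y⟩ := z
    obtain ⟨p, rfl⟩ := rootClass_surjective x
    obtain ⟨q, rfl⟩ := rootClass_surjective y
    obtain ⟨r, S, h1, h2⟩ := exists_flipRoots_of_intensity_eq h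
    exact ⟨S, r, Prod.ext h1 h2⟩
  · rintro ⟨S, q, rfl⟩
    exact pairOfRoots_mem_incidence S q

theorem fourierPoly_signalOfRoots_eq_prod {N : ℕ} (q : RootData N) :
    fourierPoly (signalOfRoots q) =
      C ((q.1.1 : ℂ) * ∏ i, -q.1.2 i) * ∏ i, (X - C (q.1.2 i)⁻¹) := by
  rw [fourierPoly_signalOfRoots, invRootPoly_eq_prod_X_sub_C q.2.2, C_mul, mul_assoc]

theorem pairOfRoots_mem_incidenceComponent {N : ℕ} (S : Finset (Fin N)) (q : RootData N) :
    pairOfRoots S q ∈ incidenceComponent N S.card := by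
  refine ⟨pairOfRoots_mem_incidence S q, signalOfRoots q, signalOfRoots (flipRoots S q),
    fun i => (q.1.2 i)⁻¹, S, _, (flipRoots S q).1.1 * ∏ i, -(flipRoots S q).1.2 i,
    rfl, rfl, rfl, fourierPoly_signalOfRoots_eq_prod q,
    (fourierPoly_signalOfRoots_eq_prod _).trans ?_⟩
  congr 1
  refine Finset.prod_congr rfl fun i _ => ?_
  by_cases h : i ∈ S <;> simp [flipRoots, flipVec, h]

theorem mem_incidenceComponent_iff {N k : ℕ} {z : SignalClass N × SignalClass N} :
    z ∈ incidenceComponent N k ↔ ∃ S q, S.card = k ∧ pairOfRoots S q = z := by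
  constructor
  · rintro ⟨hz, x, y, β, S, a, b, hx, hy, hS, hxβ, hyβ⟩
    obtain ⟨p, hp, hpx⟩ := toClass_eq_rootClass hxβ
    obtain ⟨q, hq, hqy⟩ := toClass_eq_rootClass hyβ
    refine ⟨S, p, hS, Prod.ext (hpx.trans hx) ?_⟩
    rw [← hy, ← hqy]
    refine rootClass_eq_of_intensity_eq ?_ (Multiset.map_congr rfl fun i _ => ?_)
    · rw [intensity_flipRoots, hpx, hqy, hx, hy]
      exact hz
    · rw [hq]
      by_cases h : i ∈ S <;> simp [flipRoots, flipVec, h, hp]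
  · rintro ⟨S, q, rfl, rfl⟩
    exact pairOfRoots_mem_incidenceComponent S q

/-- All choices of `k` roots to be reflected give the same set of pairs, because the enumeration of
the roots is arbitrary. -/
theorem incidenceComponent_eq_range {N : ℕ} (S : Finset (Fin N)) :
    incidenceComponent N S.card = Set.range (pairOfRoots S) := by
  ext z
  rw [mem_incidenceComponent_iff]
  constructor
  · rintro ⟨T, q, hT, rfl⟩
    obtain ⟨σ, rfl⟩ := Equiv.Perm.exists_map_finset_eq S T hT.symm
    exact ⟨permRoots σ q,
      Prod.ext (rootClass_permRoots σ q) (rootClass_flipRoots_permRoots S σ q)⟩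
  · rintro ⟨q, rfl⟩
    exact ⟨S, q, rfl, rfl⟩

theorem exists_card_eq_of_le {N k : ℕ} (hk : k ≤ N) : ∃ S : Finset (Fin N), S.card = k := by
  obtain ⟨S, -, hS⟩ := Finset.exists_subset_card_eq (s := (Finset.univ : Finset (Fin N))) (n := k)
    (by simpa using hk)
  exact ⟨S, hS⟩

theorem mk_mem_incidence_iff {N : ℕ} {q : RootData N} {y : SignalClass N} :
    (rootClass q, y) ∈ incidence N ↔ ∃ S, rootClass (flipRoots S q) = y := by
  rw [mem_incidence_iff]
  constructor
  · rintro ⟨S, p, h⟩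
    obtain ⟨h1, rfl⟩ := Prod.ext_iff.1 h
    obtain ⟨σ, rfl⟩ := rootClass_eq_iff.1 h1
    exact ⟨_, (rootClass_flipRoots_permRoots S σ q).symm⟩
  · rintro ⟨S, rfl⟩
    exact ⟨S, q, rfl⟩

theorem mk_mem_incidenceComponent_iff {N k : ℕ} {q : RootData N} {y : SignalClass N} :
    (rootClass q, y) ∈ incidenceComponent N k ↔
      ∃ S, S.card = k ∧ rootClass (flipRoots S q) = y := by
  rw [mem_incidenceComponent_iff]
  constructor
  · rintro ⟨S, p, hS, h⟩
    obtain ⟨h1, rfl⟩ := Prod.ext_iff.1 h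
    obtain ⟨σ, rfl⟩ := rootClass_eq_iff.1 h1
    exact ⟨_, by simpa using hS, (rootClass_flipRoots_permRoots S σ q).symm⟩
  · rintro ⟨S, hS, rfl⟩
    exact ⟨S, q, hS, rfl⟩

theorem incidence_eq_iUnion (N : ℕ) :
    incidence N = ⋃ k : Fin (N + 1), incidenceComponent N k := by
  ext z
  rw [Set.mem_iUnion, mem_incidence_iff]
  constructor
  · rintro ⟨S, q, rfl⟩
    refine ⟨⟨S.card, ?_⟩, pairOfRoots_mem_incidenceComponent S q⟩
    exact Nat.lt_succ_iff.2 ((Finset.card_le_univ S).trans (by simp))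
  · rintro ⟨k, hk⟩
    exact mem_incidence_iff.1 hk.1

/-! ### Conjugation and reflection -/

theorem eval_fourierPoly_reflectSignal {N : ℕ} (x : Signal N) {z : ℂ} (hz : z ≠ 0) :
    (fourierPoly (reflectSignal x)).eval z =
      z ^ N * conj ((fourierPoly x).eval (conj z)⁻¹) := by
  simp only [fourierPoly, reflectSignal, eval_finsetSum, eval_mul, eval_C, eval_pow, eval_X,
    map_sum, map_mul, map_pow, map_inv₀, Complex.conj_conj, Finset.mul_sum]
  rw [← Equiv.sum_comp Fin.revPerm]
  refine Finset.sum_congr rfl fun n _ => ?_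
  have hn : (n : ℕ) ≤ N := Nat.lt_succ_iff.1 n.2
  rw [Fin.revPerm_apply, Fin.rev_rev, mul_left_comm, Fin.val_rev, Nat.add_sub_add_right, inv_pow,
    ← pow_sub₀ z hz hn]

theorem intensity_reflectClass {N : ℕ} (z : SignalClass N) :
    intensity (reflectClass z) = intensity z := by
  obtain ⟨x, rfl⟩ := Quotient.exists_rep z
  funext ω
  change ‖(fourierPoly (reflectSignal x)).eval (ω : ℂ)‖ ^ 2 = ‖(fourierPoly x).eval (ω : ℂ)‖ ^ 2
  rw [eval_fourierPoly_reflectSignal x (Circle.coe_ne_zero ω), norm_mul, norm_pow, Circle.norm_coe,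
    one_pow, one_mul, Complex.norm_conj, ← Circle.coe_inv_eq_conj, ← Circle.coe_inv, inv_inv]

/-- Conjugation and reflection of a signal reflects all its roots. -/
theorem reflectClass_rootClass {N : ℕ} (q : RootData N) :
    reflectClass (rootClass q) = rootClass (flipRoots Finset.univ q) := by
  have h : fourierPoly (reflectSignal (signalOfRoots q)) =
      C (q.1.1 : ℂ) * ∏ i, (X - C (conj (q.1.2 i))) := by
    refine eq_of_infinite_eval_eq _ _ ((Set.finite_singleton (0 : ℂ)).infinite_compl.mono ?_)
    intro z hz
    have hz : z ≠ 0 := hz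
    have hN : z ^ N = ∏ _i : Fin N, z := by simp
    rw [Set.mem_ofPred_eq, eval_fourierPoly_reflectSignal _ hz, fourierPoly_signalOfRoots,
      eval_C_mul, eval_C_mul, map_mul, Complex.conj_ofReal, mul_left_comm, hN, eval_invRootPoly,
      map_prod, ← Finset.prod_mul_distrib, eval_prod]
    congr 1
    refine Finset.prod_congr rfl fun i _ => ?_
    simp only [map_sub, map_one, map_mul, map_inv₀, Complex.conj_conj, eval_sub, eval_X, eval_C]
    field_simp
  obtain ⟨r, hr, hr'⟩ := toClass_eq_rootClass h
  change toClass (reflectSignal (signalOfRoots q)) = _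
  rw [← hr']
  refine rootClass_eq_of_intensity_eq ?_ (Multiset.map_congr rfl fun i _ => ?_)
  · rw [intensity_flipRoots, hr', ← intensity_reflectClass (rootClass q)]
    rfl
  · simp [hr, flipRoots, flipVec]

theorem reflectSecond_pairOfRoots {N : ℕ} (S : Finset (Fin N)) (q : RootData N) :
    reflectSecond (pairOfRoots S q) = pairOfRoots Sᶜ q :=
  Prod.ext rfl (by
    simp only [reflectSecond, pairOfRoots, reflectClass_rootClass, flipRoots_univ_flipRoots])

theorem reflectClass_involutive {N : ℕ} : Function.Involutive (reflectClass (N := N)) := by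
  intro z
  obtain ⟨q, rfl⟩ := rootClass_surjective z
  rw [reflectClass_rootClass, reflectClass_rootClass, flipRoots_univ_flipRoots, Finset.compl_univ,
    flipRoots_empty]

theorem reflectSecond_involutive {N : ℕ} : Function.Involutive (reflectSecond (N := N)) :=
  fun _ => Prod.ext rfl (reflectClass_involutive _)

theorem reflectSecond_mem_incidence {N : ℕ} {z : SignalClass N × SignalClass N}
    (hz : z ∈ incidence N) : reflectSecond z ∈ incidence N := by
  change intensity z.1 = intensity (reflectClass z.2)
  rw [intensity_reflectClass]
  exact hz

theorem reflectSecond_mem_incidenceComponent {N k : ℕ} {z : SignalClass N × SignalClass N}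
    (hz : z ∈ incidenceComponent N k) : reflectSecond z ∈ incidenceComponent N (N - k) := by
  obtain ⟨S, q, rfl, rfl⟩ := mem_incidenceComponent_iff.1 hz
  have := pairOfRoots_mem_incidenceComponent Sᶜ q
  rwa [Finset.card_compl, Fintype.card_fin, ← reflectSecond_pairOfRoots] at this

theorem image_reflectSecond_incidenceComponent {N k : ℕ} (hk : k ≤ N) :
    reflectSecond '' incidenceComponent N k = incidenceComponent N (N - k) := by
  refine Set.Subset.antisymm ?_ fun z hz => ?_
  · rintro _ ⟨z, hz, rfl⟩
    exact reflectSecond_mem_incidenceComponent hz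
  · refine ⟨reflectSecond z, ?_, reflectSecond_involutive z⟩
    have := reflectSecond_mem_incidenceComponent hz
    rwa [Nat.sub_sub_self hk] at this

theorem mem_incidenceComponent_zero_iff {N : ℕ} {z : SignalClass N × SignalClass N} :
    z ∈ incidenceComponent N 0 ↔ z.2 = z.1 := by
  obtain ⟨x, y⟩ := z
  obtain ⟨q, rfl⟩ := rootClass_surjective x
  rw [mk_mem_incidenceComponent_iff]
  simp only [Finset.card_eq_zero, exists_eq_left, flipRoots_empty, eq_comm]

theorem mem_incidenceComponent_self_iff {N : ℕ} {z : SignalClass N × SignalClass N} :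
    z ∈ incidenceComponent N N ↔ z.2 = reflectClass z.1 := by
  obtain ⟨x, y⟩ := z
  obtain ⟨q, rfl⟩ := rootClass_surjective x
  rw [mk_mem_incidenceComponent_iff]
  have : ∀ S : Finset (Fin N), S.card = N ↔ S = Finset.univ := fun S => by
    rw [← Finset.card_eq_iff_eq_univ, Fintype.card_fin]
  simp only [this, exists_eq_left, reflectClass_rootClass, eq_comm]

theorem isTrivialAmbiguity_iff {N : ℕ} {z : SignalClass N × SignalClass N} :
    IsTrivialAmbiguity z.1 z.2 ↔ z ∈ incidenceComponent N 0 ∪ incidenceComponent N N := by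
  rw [Set.mem_union, mem_incidenceComponent_zero_iff, mem_incidenceComponent_self_iff]
  rfl

/-! ### A signal with roots in general position -/

/-- Distinct inverse roots outside the closed unit disc. -/
noncomputable def genericRoots (N : ℕ) : RootData N :=
  ⟨(1, fun i => (i : ℂ) + 2), one_pos, fun i => by
    have h : (((i : ℕ) + 2 : ℕ) : ℂ) ≠ 0 := Nat.cast_ne_zero.2 (by omega)
    simpa using h⟩

theorem rootClass_flipRoots_genericRoots_injective (N : ℕ) :
    Function.Injective fun S => rootClass (flipRoots S (genericRoots N)) := by
  intro S T h
  obtain ⟨-, hm⟩ := eq_of_rootClass_eq h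
  -- an inverse root of modulus above one is not reflected, and tells its index
  have key : ∀ U V : Finset (Fin N),
      Finset.univ.val.map (flipVec U (genericRoots N).1.2) =
        Finset.univ.val.map (flipVec V (genericRoots N).1.2) → U ⊆ V := by
    intro U V h i hi
    by_contra hV
    obtain ⟨σ, hσ⟩ := Multiset.exists_perm_of_map_univ_eq h.symm
    have := hσ i
    rw [flipVec, flipVec, if_neg hV] at this
    have hj : ∀ j : Fin N, (genericRoots N).1.2 j = ((j + 2 : ℝ) : ℂ) := fun j => by
      simp [genericRoots]
    rw [hj, hj, Complex.conj_ofReal, ← Complex.ofReal_inv] at this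
    by_cases hσU : σ i ∈ U
    · rw [if_pos hσU] at this
      have h1 := Complex.ofReal_injective this
      have h2 : ((σ i : ℕ) + 2 : ℝ)⁻¹ < 1 :=
        inv_lt_one_of_one_lt₀ (by linarith [(σ i : ℕ).cast_nonneg (α := ℝ)])
      linarith [(i : ℕ).cast_nonneg (α := ℝ)]
    · rw [if_neg hσU] at this
      have h1 := Complex.ofReal_injective this
      have h2 : σ i = i := Fin.ext (by exact_mod_cast add_right_cancel h1)
      exact hσU (h2.symm ▸ hi)
  exact Finset.Subset.antisymm (key _ _ hm) (key _ _ hm.symm)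

/-! ### Analyticity and continuity of the parametrisation -/

theorem analyticAt_coeff_prod {E : Type*} [NormedAddCommGroup E] [NormedSpace ℝ E] {ι : Type*}
    (s : Finset ι) {α : ι → E → ℂ} {e : E} (h : ∀ i, AnalyticAt ℝ (α i) e) (n : ℕ) :
    AnalyticAt ℝ (fun e => (∏ i ∈ s, (1 - C (α i e) * X)).coeff n) e := by
  classical
  induction s using Finset.induction_on generalizing n with
  | empty => simpa using analyticAt_const
  | insert i s hi ih =>
    simp only [Finset.prod_insert hi, sub_mul, one_mul, mul_assoc, coeff_sub, coeff_C_mul]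
    cases n with
    | zero => simpa using ih 0
    | succ n =>
      simp only [coeff_X_mul]
      exact (ih (n + 1)).sub ((h i).mul (ih n))

theorem continuous_coeff_invRootPoly {N : ℕ} (n : ℕ) :
    Continuous fun α : Fin N → ℂ => (invRootPoly α).coeff n := by
  refine continuous_iff_continuousAt.2 fun α => AnalyticAt.continuousAt (𝕜 := ℝ) ?_
  exact analyticAt_coeff_prod Finset.univ
    (fun i => (ContinuousLinearMap.proj (R := ℝ) (φ := fun _ : Fin N => ℂ) i).analyticAt α) n

theorem continuous_toClass {N : ℕ} : Continuous (toClass (N := N)) :=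
  continuous_quotient_mk'

theorem continuous_rootClass {N : ℕ} : Continuous (rootClass (N := N)) := by
  refine continuous_toClass.comp (Continuous.subtype_mk (continuous_pi fun n => ?_) _)
  exact (Complex.continuous_ofReal.comp (continuous_fst.comp continuous_subtype_val)).mul
    ((continuous_coeff_invRootPoly n).comp (continuous_snd.comp continuous_subtype_val))

theorem continuous_normalForm {N : ℕ} : Continuous (normalForm (N := N)) := by
  refine Continuous.quotient_lift (continuous_pi fun n => ?_) _
  have h : ∀ x : Signal N, (‖x.1 0‖ : ℂ) ≠ 0 := fun x => by simpa using x.2.1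
  have h1 : ∀ n, Continuous fun x : Signal N => x.1 n := fun n =>
    (continuous_apply n).comp continuous_subtype_val
  exact ((Complex.continuous_conj.comp (h1 0)).div
    (Complex.continuous_ofReal.comp (h1 0).norm) h).mul (h1 n)

instance t2Space_signalClass {N : ℕ} : T2Space (SignalClass N) :=
  T2Space.of_injective_continuous normalForm_injective continuous_normalForm

theorem continuous_permRoots {N : ℕ} (σ : Equiv.Perm (Fin N)) : Continuous (permRoots σ) := by
  refine Continuous.subtype_mk (Continuous.prodMk (by fun_prop) (continuous_pi fun i => ?_)) _
  exact (continuous_apply (σ i)).comp (continuous_snd.comp continuous_subtype_val)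

theorem continuous_flipRoots {N : ℕ} (S : Finset (Fin N)) : Continuous (flipRoots S) := by
  have h : ∀ i, Continuous fun q : RootData N => q.1.2 i := fun i =>
    (continuous_apply i).comp (continuous_snd.comp continuous_subtype_val)
  refine Continuous.subtype_mk (Continuous.prodMk ?_ (continuous_pi fun i => ?_)) _
  · exact (continuous_fst.comp continuous_subtype_val).mul
      (continuous_finsetProd _ fun i _ => (h i).norm)
  · by_cases hi : i ∈ S
    · simp only [flipVec, if_pos hi]
      exact (Complex.continuous_conj.comp (h i)).inv₀ fun q => by simpa using q.2.2 i
    · simpa only [flipVec, if_neg hi] using h i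

theorem continuous_pairOfRoots {N : ℕ} (S : Finset (Fin N)) : Continuous (pairOfRoots S) :=
  continuous_rootClass.prodMk (continuous_rootClass.comp (continuous_flipRoots S))

instance locallyPathConnectedSpace_rootData {N : ℕ} : LocallyPathConnectedSpace (RootData N) := by
  have h : IsOpen {q : ℝ × (Fin N → ℂ) | 0 < q.1 ∧ ∀ i, q.2 i ≠ 0} := by
    have : {q : ℝ × (Fin N → ℂ) | 0 < q.1 ∧ ∀ i, q.2 i ≠ 0} =
        {q | 0 < q.1} ∩ ⋂ i, {q | q.2 i ≠ 0} := by
      ext q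
      simp
    rw [this]
    exact (isOpen_lt continuous_const continuous_fst).inter (isOpen_iInter_of_finite fun i =>
      isOpen_ne_fun ((continuous_apply i).comp continuous_snd) continuous_const)
  exact h.locallyPathConnectedSpace

/-- Exponential coordinates on the parameter space. -/
noncomputable def expRoots {N : ℕ} (e : ℝ × (Fin N → ℂ)) : RootData N :=
  ⟨(Real.exp e.1, fun i => Complex.exp (e.2 i)), Real.exp_pos _, fun _ => Complex.exp_ne_zero _⟩

theorem continuous_expRoots {N : ℕ} : Continuous (expRoots (N := N)) :=
  Continuous.subtype_mk ((Real.continuous_exp.comp continuous_fst).prodMk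
    (continuous_pi fun i =>
      Complex.continuous_exp.comp ((continuous_apply i).comp continuous_snd))) _

theorem expRoots_surjective {N : ℕ} : Function.Surjective (expRoots (N := N)) := fun q =>
  ⟨(Real.log q.1.1, fun i => Complex.log (q.1.2 i)), Subtype.ext (Prod.ext
    (Real.exp_log q.2.1) (funext fun i => Complex.exp_log (q.2.2 i)))⟩

instance connectedSpace_rootData {N : ℕ} : ConnectedSpace (RootData N) :=
  expRoots_surjective.connectedSpace continuous_expRoots

/-! ### Continuity of roots -/

/-- A bound for inverse roots by the coefficients. -/
theorem norm_le_sum_coeff_invRootPoly {N : ℕ} (α : Fin N → ℂ) (i : Fin N) :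
    ‖α i‖ ≤ ∑ n : Fin (N + 1), ‖(invRootPoly α).coeff n‖ := by
  rw [Fin.sum_univ_succ, Fin.val_zero, coeff_zero_invRootPoly, norm_one]
  rcases le_total ‖α i‖ 1 with h | h
  · exact h.trans (le_add_of_nonneg_right (Finset.sum_nonneg fun _ _ => norm_nonneg _))
  · have h0 : α i ≠ 0 := norm_pos_iff.1 (one_pos.trans_le h)
    have hz : ‖(α i)⁻¹‖ ≤ 1 := by
      rw [norm_inv]
      exact inv_le_one_of_one_le₀ h
    have h1 : (invRootPoly α).eval (α i)⁻¹ = 0 := by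
      rw [eval_invRootPoly]
      exact Finset.prod_eq_zero (Finset.mem_univ i) (by rw [mul_inv_cancel₀ h0, sub_self])
    rw [← sum_C_coeff_mul_X_pow (natDegree_invRootPoly_le α), Fin.sum_univ_succ, eval_add,
      eval_finsetSum] at h1
    simp only [Fin.val_zero, pow_zero, mul_one, eval_C, coeff_zero_invRootPoly, eval_mul, eval_pow,
      eval_X, Fin.val_succ] at h1
    have h2 : (1 : ℝ) ≤ ‖(α i)⁻¹‖ * ∑ n : Fin N, ‖(invRootPoly α).coeff (n + 1)‖ := by
      calc (1 : ℝ) = ‖∑ n : Fin N, (invRootPoly α).coeff (n + 1) * (α i)⁻¹ ^ ((n : ℕ) + 1)‖ := by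
            rw [eq_neg_of_add_eq_zero_right h1, norm_neg, norm_one]
        _ ≤ ∑ n : Fin N, ‖(α i)⁻¹‖ * ‖(invRootPoly α).coeff (n + 1)‖ := by
            refine norm_sum_le_of_le _ fun n _ => ?_
            rw [norm_mul, norm_pow, mul_comm, pow_succ']
            refine mul_le_mul_of_nonneg_right ?_ (norm_nonneg _)
            exact mul_le_of_le_one_right (norm_nonneg _) (pow_le_one₀ (norm_nonneg _) hz)
        _ = _ := by rw [Finset.mul_sum]
    rw [norm_inv, ← div_eq_inv_mul, one_le_div (one_pos.trans_le h)] at h2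
    simp only [Fin.val_succ]
    linarith

theorem tendsto_of_tendsto_rootClass {N : ℕ} {l : Filter (RootData N)} {q : RootData N}
    (h : Filter.Tendsto rootClass l (𝓝 (rootClass q))) :
    Filter.Tendsto (fun p => p.1.1) l (𝓝 q.1.1) ∧ ∀ n : Fin (N + 1), Filter.Tendsto
      (fun p => (invRootPoly p.1.2).coeff n) l (𝓝 ((invRootPoly q.1.2).coeff n)) := by
  have hv : ∀ n : Fin (N + 1), Filter.Tendsto
      (fun p : RootData N => (p.1.1 : ℂ) * (invRootPoly p.1.2).coeff n) l
        (𝓝 ((q.1.1 : ℂ) * (invRootPoly q.1.2).coeff n)) := by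
    intro n
    have h1 := (((continuous_apply n).comp continuous_normalForm).tendsto (rootClass q)).comp h
    simpa only [Function.comp_def, normalForm_rootClass, signalOfRoots] using h1
  have hc : Filter.Tendsto (fun p : RootData N => (p.1.1 : ℂ)) l (𝓝 (q.1.1 : ℂ)) := by
    simpa only [Fin.val_zero, coeff_zero_invRootPoly, mul_one] using hv 0
  have hq0 : (q.1.1 : ℂ) ≠ 0 := Complex.ofReal_ne_zero.2 q.2.1.ne'
  refine ⟨(Complex.continuous_re.tendsto _).comp hc, fun n => ?_⟩
  have h1 := (hv n).div hc hq0
  rw [mul_div_cancel_left₀ _ hq0] at h1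
  exact h1.congr fun p => mul_div_cancel_left₀ _ (Complex.ofReal_ne_zero.2 p.2.1.ne')

/-- The roots of a signal depend continuously on the signal, and stay in a compact part of the
punctured plane as long as the signal does not degenerate. -/
theorem isProperMap_rootClass {N : ℕ} : IsProperMap (rootClass (N := N)) := by
  refine isProperMap_iff_ultrafilter_of_t2.2 ⟨continuous_rootClass, fun 𝒰 y hy => ?_⟩
  obtain ⟨q, rfl⟩ := rootClass_surjective y
  obtain ⟨hc, hcoeff⟩ := tendsto_of_tendsto_rootClass hy
  have hsum := tendsto_finsetSum Finset.univ fun n (_ : n ∈ Finset.univ) => (hcoeff n).norm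
  obtain ⟨L, hL⟩ : ∃ L, ∑ n : Fin (N + 1), ‖(invRootPoly q.1.2).coeff n‖ = L := ⟨_, rfl⟩
  have hL0 : 0 ≤ L := hL ▸ Finset.sum_nonneg fun _ _ => norm_nonneg _
  rw [hL] at hsum
  have hbound : ∀ᶠ p : RootData N in 𝒰, p.1.2 ∈ Metric.closedBall (0 : Fin N → ℂ) (L + 1) := by
    filter_upwards [hsum.eventually_le_const (lt_add_one L)] with p hp
    rw [mem_closedBall_zero_iff, pi_norm_le_iff_of_nonneg (add_nonneg hL0 zero_le_one)]
    exact fun i => (norm_le_sum_coeff_invRootPoly p.1.2 i).trans hp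
  have hmem : Metric.closedBall (0 : Fin N → ℂ) (L + 1) ∈ 𝒰.map fun p : RootData N => p.1.2 :=
    Ultrafilter.mem_map.2 hbound
  obtain ⟨a, -, ha⟩ := isCompact_iff_ultrafilter_le_nhds'.1
    (isCompact_closedBall (0 : Fin N → ℂ) (L + 1)) _ hmem
  have ha : Filter.Tendsto (fun p : RootData N => p.1.2) 𝒰 (𝓝 a) := ha
  -- the product of the limits is the limit of the top coefficients, which is not zero
  have hai : ∀ i, a i ≠ 0 := by
    have h1 := ((continuous_coeff_invRootPoly N).tendsto a).comp ha
    have h2 := tendsto_nhds_unique h1 (hcoeff (Fin.last N))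
    have h3 : (invRootPoly q.1.2).coeff N ≠ 0 := by
      rw [coeff_top_invRootPoly]
      exact Finset.prod_ne_zero_iff.2 fun i _ => neg_ne_zero.2 (q.2.2 i)
    rw [Fin.val_last] at h2
    rw [← h2, coeff_top_invRootPoly, Finset.prod_ne_zero_iff] at h3
    exact fun i => neg_ne_zero.1 (h3 i (Finset.mem_univ i))
  refine ⟨⟨(q.1.1, a), q.2.1, hai⟩, ?_⟩
  rw [nhds_subtype_eq_comap, ← Filter.map_le_iff_le_comap]
  exact Filter.Tendsto.prodMk_nhds hc ha

theorem isQuotientMap_rootClass {N : ℕ} : IsQuotientMap (rootClass (N := N)) :=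
  isProperMap_rootClass.isClosedMap.isQuotientMap continuous_rootClass rootClass_surjective

/-- The saturation of an open set is the union of its translates by permutations. -/
theorem isOpenMap_rootClass {N : ℕ} : IsOpenMap (rootClass (N := N)) := by
  intro U hU
  rw [← isQuotientMap_rootClass.isOpen_preimage]
  have : rootClass ⁻¹' (rootClass '' U) = ⋃ σ, permRoots σ ⁻¹' U := by
    ext q
    simp only [Set.mem_preimage, Set.mem_image, Set.mem_iUnion]
    constructor
    · rintro ⟨p, hp, h⟩
      obtain ⟨σ, rfl⟩ := rootClass_eq_iff.1 h
      exact ⟨σ, hp⟩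
    · rintro ⟨σ, hσ⟩
      exact ⟨_, hσ, rootClass_permRoots σ q⟩
  rw [this]
  exact isOpen_iUnion fun σ => hU.preimage (continuous_permRoots σ)

instance connectedSpace_signalClass {N : ℕ} : ConnectedSpace (SignalClass N) :=
  rootClass_surjective.connectedSpace continuous_rootClass

instance locallyPathConnectedSpace_signalClass {N : ℕ} :
    LocallyPathConnectedSpace (SignalClass N) :=
  isQuotientMap_rootClass.locallyPathConnectedSpace

theorem continuous_reflectClass {N : ℕ} : Continuous (reflectClass (N := N)) := by
  rw [isQuotientMap_rootClass.continuous_iff]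
  have : reflectClass ∘ rootClass = rootClass ∘ flipRoots (Finset.univ : Finset (Fin N)) :=
    funext reflectClass_rootClass
  rw [this]
  exact continuous_rootClass.comp (continuous_flipRoots _)

theorem continuous_reflectSecond {N : ℕ} : Continuous (reflectSecond (N := N)) :=
  continuous_fst.prodMk (continuous_reflectClass.comp continuous_snd)

/-! ### Finite covers -/

/-- Roots on the unit circle are not changed by reflection. -/
theorem exists_flipRoots_eq_self (N : ℕ) : ∃ q : RootData N, ∀ S, flipRoots S q = q := by
  refine ⟨⟨(1, fun _ => 1), one_pos, fun _ => one_ne_zero⟩, fun S => ?_⟩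
  exact Subtype.ext (Prod.ext (by simp [flipRoots]) (by funext i; simp [flipRoots, flipVec]))

/-- The parametrisation of a union of pieces of the incidence set by roots and sets of roots to be
reflected. -/
noncomputable def sigmaPair {N : ℕ} (T : Finset (Finset (Fin N))) (a : Σ _ : T, RootData N) :
    SignalClass N × SignalClass N :=
  pairOfRoots a.1.1 a.2

theorem isProperMap_fst_sigmaPair {N : ℕ} (T : Finset (Finset (Fin N))) :
    IsProperMap fun a => (sigmaPair T a).1 := by
  refine isProperMap_iff_isClosedMap_and_compact_fibers.2
    ⟨continuous_sigma fun _ => continuous_rootClass, fun K hK => ?_, fun x => ?_⟩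
  · have : (fun a => (sigmaPair T a).1) '' K = ⋃ S : T, rootClass '' {q | ⟨S, q⟩ ∈ K} := by
      ext x
      simp only [Set.mem_image, Set.mem_iUnion, Sigma.exists]
      rfl
    rw [this]
    exact isClosed_iUnion_of_finite fun S =>
      isProperMap_rootClass.isClosedMap _ (hK.preimage continuous_sigmaMk)
  · have : (fun a => (sigmaPair T a).1) ⁻¹' {x} =
        ⋃ S : T, Sigma.mk (β := fun _ : T => RootData N) S '' (rootClass ⁻¹' {x}) := by
      ext ⟨S, q⟩
      simp [sigmaPair, pairOfRoots]
    rw [this]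
    exact isCompact_iUnion fun S =>
      (isProperMap_rootClass.isCompact_preimage isCompact_singleton).image continuous_sigmaMk

theorem continuous_sigmaPair {N : ℕ} (T : Finset (Finset (Fin N))) : Continuous (sigmaPair T) :=
  continuous_sigma fun S => continuous_pairOfRoots S.1

theorem isProperMap_sigmaPair {N : ℕ} (T : Finset (Finset (Fin N))) : IsProperMap (sigmaPair T) :=
  isProperMap_of_comp_of_t2 (continuous_sigmaPair T) continuous_fst (isProperMap_fst_sigmaPair T)

theorem isOpenMap_fst_sigmaPair {N : ℕ} (T : Finset (Finset (Fin N))) :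
    IsOpenMap fun a => (sigmaPair T a).1 :=
  isOpenMap_sigma.2 fun _ => isOpenMap_rootClass

/-- `s` consists of the pairs obtained by reflecting a set of roots that belongs to `T`. -/
def IsFlipSet {N : ℕ} (T : Finset (Finset (Fin N))) (s : Set (SignalClass N × SignalClass N)) :
    Prop :=
  ∀ q y, (rootClass q, y) ∈ s ↔ ∃ S ∈ T, rootClass (flipRoots S q) = y

theorem IsFlipSet.range_sigmaPair {N : ℕ} {T : Finset (Finset (Fin N))}
    {s : Set (SignalClass N × SignalClass N)} (hs : IsFlipSet T s) :
    Set.range (sigmaPair T) = s := by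
  ext ⟨x, y⟩
  constructor
  · rintro ⟨⟨S, q⟩, h⟩
    rw [← h]
    exact (hs q _).2 ⟨S.1, S.2, rfl⟩
  · intro h
    obtain ⟨q, rfl⟩ := rootClass_surjective x
    obtain ⟨S, hS, rfl⟩ := (hs q y).1 h
    exact ⟨⟨⟨S, hS⟩, q⟩, rfl⟩

theorem IsFlipSet.isClosed {N : ℕ} {T : Finset (Finset (Fin N))}
    {s : Set (SignalClass N × SignalClass N)} (hs : IsFlipSet T s) : IsClosed s :=
  hs.range_sigmaPair ▸ (isProperMap_sigmaPair T).isClosedMap.isClosed_range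

/-- The images of the connected parameter space under the different parametrisations meet in the
pairs of equal signals with all roots on the unit circle. -/
theorem IsFlipSet.isConnected {N : ℕ} {T : Finset (Finset (Fin N))}
    {s : Set (SignalClass N × SignalClass N)} (hs : IsFlipSet T s) (hT : T.Nonempty) :
    IsConnected s := by
  obtain ⟨q, hq⟩ := exists_flipRoots_eq_self N
  have hU : s = ⋃ S : T, Set.range (pairOfRoots S.1) := by
    rw [← hs.range_sigmaPair]
    ext z
    simp only [Set.mem_range, Set.mem_iUnion, Sigma.exists]
    rfl
  obtain ⟨S₀, hS₀⟩ := hT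
  have hmem : ∀ S : T, (rootClass q, rootClass q) ∈ Set.range (pairOfRoots S.1) := fun S =>
    ⟨q, by rw [pairOfRoots, hq]⟩
  rw [hU]
  refine ⟨⟨_, Set.mem_iUnion.2 ⟨⟨S₀, hS₀⟩, hmem _⟩⟩, ?_⟩
  exact isPreconnected_iUnion ⟨_, Set.mem_iInter.2 hmem⟩ fun S =>
    isPreconnected_range (continuous_pairOfRoots S.1)

theorem encard_fiber_firstProj {N : ℕ} (s : Set (SignalClass N × SignalClass N))
    (x : SignalClass N) : (firstProj s ⁻¹' {x}).encard = {y | (x, y) ∈ s}.encard := by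
  have hinj : Set.InjOn (fun p : s => p.1.2) (firstProj s ⁻¹' {x}) := fun p hp p' hp' h =>
    Subtype.ext (Prod.ext ((show p.1.1 = x from hp).trans (show p'.1.1 = x from hp').symm) h)
  rw [← hinj.encard_image]
  congr 1
  ext y
  constructor
  · rintro ⟨p, hp, rfl⟩
    obtain rfl : p.1.1 = x := hp
    exact p.2
  · intro hy
    exact ⟨⟨(x, y), hy⟩, rfl, rfl⟩

theorem IsFlipSet.fiber_eq {N : ℕ} {T : Finset (Finset (Fin N))}
    {s : Set (SignalClass N × SignalClass N)} (hs : IsFlipSet T s) (q : RootData N) :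
    {y | (rootClass q, y) ∈ s} = (fun S => rootClass (flipRoots S q)) '' T := by
  ext y
  exact hs q y

theorem IsFlipSet.encard_fiber_le {N : ℕ} {T : Finset (Finset (Fin N))}
    {s : Set (SignalClass N × SignalClass N)} (hs : IsFlipSet T s) (x : SignalClass N) :
    (firstProj s ⁻¹' {x}).encard ≤ T.card := by
  obtain ⟨q, rfl⟩ := rootClass_surjective x
  rw [encard_fiber_firstProj, hs.fiber_eq, ← Set.encard_coe_eq_coe_finsetCard]
  exact Set.encard_image_le _ _

/-- The bound for the fibres is attained over a signal with roots in general position. -/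
theorem IsFlipSet.coverDegree_eq {N : ℕ} {T : Finset (Finset (Fin N))}
    {s : Set (SignalClass N × SignalClass N)} (hs : IsFlipSet T s) :
    coverDegree (firstProj s) = T.card := by
  refine le_antisymm (iSup_le hs.encard_fiber_le) ?_
  refine le_iSup_of_le (rootClass (genericRoots N)) ?_
  rw [encard_fiber_firstProj, hs.fiber_eq,
    (rootClass_flipRoots_genericRoots_injective N).encard_image, Set.encard_coe_eq_coe_finsetCard]

/-- The piece `s` is a quotient of a disjoint union of copies of the parameter space, from which it
inherits local connectedness. -/
theorem IsFlipSet.isFiniteCover {N : ℕ} {T : Finset (Finset (Fin N))}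
    {s : Set (SignalClass N × SignalClass N)} (hs : IsFlipSet T s) (hT : T.Nonempty) :
    IsFiniteCover (firstProj s) := by
  have hmem : ∀ a, sigmaPair T a ∈ s := fun a => hs.range_sigmaPair.subset ⟨a, rfl⟩
  let g : (Σ _ : T, RootData N) → s := fun a => ⟨sigmaPair T a, hmem a⟩
  have hg : Continuous g := (continuous_sigmaPair T).subtype_mk _
  have hg' : Function.Surjective g := by
    rintro ⟨z, hz⟩
    rw [← hs.range_sigmaPair] at hz
    obtain ⟨a, rfl⟩ := hz
    exact ⟨a, rfl⟩
  have hf : Continuous (firstProj s) := continuous_fst.comp continuous_subtype_val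
  have hgf : IsProperMap (firstProj s ∘ g) := isProperMap_fst_sigmaPair T
  have hquot : IsQuotientMap g :=
    (isProperMap_of_comp_of_t2 hg hf hgf).isClosedMap.isQuotientMap hg hg'
  have : LocallyPathConnectedSpace s := hquot.locallyPathConnectedSpace
  refine
    { connected_source := isConnected_iff_connectedSpace.1 (hs.isConnected hT)
      connected_target := inferInstance
      locallyConnected_source := inferInstance
      locallyConnected_target := inferInstance
      hausdorff_source := inferInstance
      hausdorff_target := inferInstance
      continuous := hf
      isOpenMap := fun U hU => ?_
      isClosedMap := (isProperMap_of_comp_of_surj hg hf hgf hg').isClosedMap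
      finite_fiber := fun x => ?_
      nonempty_fiber := fun x => ?_ }
  · rw [← Set.image_preimage_eq U hg', ← Set.image_comp]
    exact isOpenMap_fst_sigmaPair T _ (hU.preimage hg)
  · exact Set.finite_of_encard_le_coe (hs.encard_fiber_le x)
  · obtain ⟨q, rfl⟩ := rootClass_surjective x
    obtain ⟨S, hS⟩ := hT
    exact ⟨g ⟨⟨S, hS⟩, q⟩, rfl⟩

theorem isFlipSet_incidence (N : ℕ) : IsFlipSet Finset.univ (incidence N) := fun q y => by
  simp only [mk_mem_incidence_iff, Finset.mem_univ, true_and]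

theorem isFlipSet_incidenceComponent (N k : ℕ) :
    IsFlipSet (Finset.powersetCard k Finset.univ) (incidenceComponent N k) := fun q y => by
  simp only [mk_mem_incidenceComponent_iff, Finset.mem_powersetCard_univ]

/-! ### Zariski closed sets and regular functions -/

theorem isClosed_zariskiTopology_iff {A ι : Type} {c : A → ι → ℝ} {Z : Set A} :
    IsClosed[zariskiTopology c] Z ↔
      ∃ F : Set (MvPolynomial ι ℝ), Z = {a | ∀ f ∈ F, MvPolynomial.eval (c a) f = 0} := by
  rw [← @isOpen_compl_iff _ _ (zariskiTopology c)]
  change Zᶜᶜ ∈ {Z : Set A | ∃ F : Set (MvPolynomial ι ℝ),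
    Z = {a | ∀ f ∈ F, MvPolynomial.eval (c a) f = 0}} ↔ _
  rw [compl_compl, Set.mem_ofPred_eq]

/-- A complex function whose real and imaginary parts are polynomials in the coordinates. -/
def IsRegularFun {A ι : Type} (c : A → ι → ℝ) (f : A → ℂ) : Prop :=
  ∃ P Q : MvPolynomial ι ℝ, ∀ a, f a = ⟨MvPolynomial.eval (c a) P, MvPolynomial.eval (c a) Q⟩

namespace IsRegularFun

variable {A ι : Type} {c : A → ι → ℝ} {f g : A → ℂ}

theorem const (z : ℂ) : IsRegularFun c fun _ => z :=
  ⟨MvPolynomial.C z.re, MvPolynomial.C z.im, fun a => by simp⟩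

theorem add (hf : IsRegularFun c f) (hg : IsRegularFun c g) :
    IsRegularFun c fun a => f a + g a := by
  obtain ⟨P, Q, h⟩ := hf
  obtain ⟨P', Q', h'⟩ := hg
  exact ⟨P + P', Q + Q', fun a => by apply Complex.ext <;> simp [h, h']⟩

theorem mul (hf : IsRegularFun c f) (hg : IsRegularFun c g) :
    IsRegularFun c fun a => f a * g a := by
  obtain ⟨P, Q, h⟩ := hf
  obtain ⟨P', Q', h'⟩ := hg
  exact ⟨P * P' - Q * Q', P * Q' + Q * P', fun a => by apply Complex.ext <;> simp [h, h']⟩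

theorem sub (hf : IsRegularFun c f) (hg : IsRegularFun c g) :
    IsRegularFun c fun a => f a - g a := by
  simpa [sub_eq_add_neg] using hf.add ((const (-1)).mul hg)

theorem conjugate (hf : IsRegularFun c f) : IsRegularFun c fun a => conj (f a) := by
  obtain ⟨P, Q, h⟩ := hf
  exact ⟨P, -Q, fun a => by apply Complex.ext <;> simp [h]⟩

theorem sum {κ : Type*} (s : Finset κ) {F : κ → A → ℂ} (h : ∀ i, IsRegularFun c (F i)) :
    IsRegularFun c fun a => ∑ i ∈ s, F i a := by
  classical
  induction s using Finset.induction_on with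
  | empty => simpa using const 0
  | insert i s hi ih => simpa only [Finset.sum_insert hi] using (h i).add ih

theorem prod {κ : Type*} (s : Finset κ) {F : κ → A → ℂ} (h : ∀ i, IsRegularFun c (F i)) :
    IsRegularFun c fun a => ∏ i ∈ s, F i a := by
  classical
  induction s using Finset.induction_on with
  | empty => simpa using const 1
  | insert i s hi ih => simpa only [Finset.prod_insert hi] using (h i).mul ih

theorem isClosed_zero (hf : IsRegularFun c f) : IsClosed[zariskiTopology c] {a | f a = 0} := by
  obtain ⟨P, Q, h⟩ := hf
  refine isClosed_zariskiTopology_iff.2 ⟨{P, Q}, ?_⟩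
  ext a
  simp [h, Complex.ext_iff]

theorem det {n : Type} [Fintype n] [DecidableEq n] {M : A → Matrix n n ℂ}
    (h : ∀ i j, IsRegularFun c fun a => M a i j) : IsRegularFun c fun a => (M a).det := by
  simp only [Matrix.det_apply']
  exact sum _ fun σ => (const _).mul (prod _ fun i => h _ _)

end IsRegularFun

open scoped ComplexOrder in
/-- Degeneration of a matrix with regular entries is a Zariski closed condition: it is expressed by
the vanishing of the Gram determinant of the columns. -/
theorem isClosed_exists_mulVec_eq_zero {A ι m n : Type} [Fintype m] [Fintype n] [DecidableEq n]
    {c : A → ι → ℝ} {M : A → Matrix m n ℂ} (h : ∀ i j, IsRegularFun c fun a => M a i j) :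
    IsClosed[zariskiTopology c] {a | ∃ w ≠ 0, (M a).mulVec w = 0} := by
  have : {a | ∃ w ≠ 0, (M a).mulVec w = 0} = {a | ((M a).conjTranspose * M a).det = 0} := by
    ext a
    rw [Set.mem_ofPred_eq, Set.mem_ofPred_eq, ← Matrix.exists_mulVec_eq_zero_iff]
    simp only [Matrix.conjTranspose_mul_self_mulVec_eq_zero]
  rw [this]
  refine (IsRegularFun.det fun i j => ?_).isClosed_zero
  simp only [Matrix.mul_apply, Matrix.conjTranspose_apply]
  exact IsRegularFun.sum _ fun k => (h k i).conjugate.mul (h k j)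

/-! ### Irreducibility -/

/-- A set with an analytic parametrisation by a vector space is irreducible in the Zariski
topology, since the product of two non-zero analytic functions is not zero. -/
theorem isIrreducible_range_of_analytic {E A ι : Type} [NormedAddCommGroup E] [NormedSpace ℝ E]
    {c : A → ι → ℝ} {Φ : E → A} (h : ∀ i e, AnalyticAt ℝ (fun e => c (Φ e) i) e) :
    @IsIrreducible A (zariskiTopology c) (Set.range Φ) := by
  have han : ∀ f : MvPolynomial ι ℝ,
      AnalyticOnNhd ℝ (fun e => MvPolynomial.eval (c (Φ e)) f) Set.univ := fun f e _ => by
    simpa only [MvPolynomial.aeval_eq_eval] using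
      AnalyticAt.aeval_mvPolynomial (fun i => h i e) f
  refine ⟨Set.range_nonempty Φ, ?_⟩
  rw [@isPreirreducible_iff_isClosed_union_isClosed _ (zariskiTopology c)]
  intro Z₁ Z₂ h₁ h₂ hsub
  obtain ⟨F, rfl⟩ := isClosed_zariskiTopology_iff.1 h₁
  obtain ⟨G, rfl⟩ := isClosed_zariskiTopology_iff.1 h₂
  by_contra! hcon
  obtain ⟨⟨_, ⟨e₁, rfl⟩, hf⟩, hG⟩ :=
    And.imp_left Set.not_subset.1 hcon
  obtain ⟨_, ⟨e₂, rfl⟩, hg⟩ := Set.not_subset.1 hG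
  simp only [Set.mem_ofPred_eq, not_forall] at hf hg
  obtain ⟨f, hfF, hf⟩ := hf
  obtain ⟨g, hgG, hg⟩ := hg
  refine hg ((han g).eqOn_zero_of_preconnected_of_eventuallyEq_zero isPreconnected_univ
    (Set.mem_univ e₁) ?_ (Set.mem_univ e₂))
  filter_upwards [((han f) e₁ (Set.mem_univ _)).continuousAt.eventually_ne hf] with e he
  rcases hsub ⟨e, rfl⟩ with h' | h'
  · exact absurd (h' f hfF) he
  · exact h' g hgG

theorem irreducibleComponents_eq_range_closure {T κ : Type*} [TopologicalSpace T] [Finite κ]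
    {S : κ → Set T} (hirr : ∀ i, IsIrreducible (S i)) (hcov : ⋃ i, S i = Set.univ)
    (hsub : ∀ i j, S i ⊆ closure (S j) → i = j) :
    irreducibleComponents T = Set.range fun i => closure (S i) := by
  have key : ∀ t : Set T, IsIrreducible t → ∃ i, t ⊆ closure (S i) := by
    intro t ht
    have hfin : (Set.range fun i => closure (S i)).Finite := Set.finite_range _
    obtain ⟨_, hz, hz'⟩ := isIrreducible_iff_sUnion_isClosed.1 ht hfin.toFinset
      (by
        intro z hz
        obtain ⟨i, rfl⟩ := hfin.mem_toFinset.1 hz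
        exact isClosed_closure)
      (by
        rw [hfin.coe_toFinset, Set.sUnion_range]
        intro x _
        obtain ⟨i, hi⟩ := Set.mem_iUnion.1 (hcov.symm.subset (Set.mem_univ x))
        exact Set.mem_iUnion.2 ⟨i, subset_closure hi⟩)
    obtain ⟨i, rfl⟩ := hfin.mem_toFinset.1 hz
    exact ⟨i, hz'⟩
  ext t
  constructor
  · intro ht
    obtain ⟨i, hi⟩ := key t ht.1
    exact ⟨i, Set.Subset.antisymm (ht.2 (hirr i).closure hi) hi⟩
  · rintro ⟨i, rfl⟩
    refine ⟨(hirr i).closure, fun t ht hit => ?_⟩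
    obtain ⟨j, hj⟩ := key t ht
    obtain rfl := hsub i j (subset_closure.trans (hit.trans hj))
    exact hj

/-! ### The incidence set in the Zariski topology -/

theorem isRegularFun_normalForm_fst {N : ℕ} (n : Fin (N + 1)) :
    IsRegularFun pairCoord fun p : SignalClass N × SignalClass N => normalForm p.1 n :=
  ⟨MvPolynomial.X (Sum.inl (n, 0)), MvPolynomial.X (Sum.inl (n, 1)), fun p => by
    simp [pairCoord, classCoord]⟩

theorem isRegularFun_normalForm_snd {N : ℕ} (n : Fin (N + 1)) :
    IsRegularFun pairCoord fun p : SignalClass N × SignalClass N => normalForm p.2 n :=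
  ⟨MvPolynomial.X (Sum.inr (n, 0)), MvPolynomial.X (Sum.inr (n, 1)), fun p => by
    simp [pairCoord, classCoord]⟩

theorem eval_fourierPoly {N : ℕ} (x : Signal N) (z : ℂ) :
    (fourierPoly x).eval z = ∑ n, x.1 n * z ^ (n : ℕ) := by
  simp [fourierPoly, eval_finsetSum]

theorem intensity_eq_normalForm {N : ℕ} (z : SignalClass N) (ω : Circle) :
    intensity z ω = ‖∑ n, normalForm z n * (ω : ℂ) ^ (n : ℕ)‖ ^ 2 := by
  obtain ⟨q, rfl⟩ := rootClass_surjective z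
  rw [normalForm_rootClass, ← eval_fourierPoly]
  rfl

theorem isClosed_incidence (N : ℕ) :
    IsClosed[zariskiTopology (pairCoord (N := N))] (incidence N) := by
  have h : incidence N = ⋂ ω : Circle, {p : SignalClass N × SignalClass N |
      (∑ n, normalForm p.1 n * (ω : ℂ) ^ (n : ℕ)) *
        conj (∑ n, normalForm p.1 n * (ω : ℂ) ^ (n : ℕ)) -
      (∑ n, normalForm p.2 n * (ω : ℂ) ^ (n : ℕ)) *
        conj (∑ n, normalForm p.2 n * (ω : ℂ) ^ (n : ℕ)) = 0} := by
    ext p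
    rw [Set.mem_iInter]
    refine funext_iff.trans (forall_congr' fun ω => ?_)
    rw [Set.mem_ofPred_eq, Complex.mul_conj', Complex.mul_conj', sub_eq_zero,
      intensity_eq_normalForm, intensity_eq_normalForm]
    norm_cast
  rw [h]
  refine @isClosed_iInter _ _ (zariskiTopology pairCoord) _ fun ω => IsRegularFun.isClosed_zero ?_
  have h1 := IsRegularFun.sum Finset.univ fun n : Fin (N + 1) =>
    (isRegularFun_normalForm_fst n).mul (.const ((ω : ℂ) ^ (n : ℕ)))
  have h2 := IsRegularFun.sum Finset.univ fun n : Fin (N + 1) =>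
    (isRegularFun_normalForm_snd n).mul (.const ((ω : ℂ) ^ (n : ℕ)))
  exact (h1.mul h1.conjugate).sub (h2.mul h2.conjugate)

theorem analyticAt_classCoord {E : Type*} [NormedAddCommGroup E] [NormedSpace ℝ E] {N : ℕ}
    {τ : E → ℝ} {ζ : Fin N → E → ℂ} {e : E} (hτ : AnalyticAt ℝ τ e)
    (hζ : ∀ i, AnalyticAt ℝ (ζ i) e) (j : Fin (N + 1) × Fin 2) :
    AnalyticAt ℝ (fun e => classCoord (rootClass (expRoots (τ e, fun i => ζ i e))) j) e := by
  have h : AnalyticAt ℝ (fun e => (Real.exp (τ e) : ℂ) *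
      (invRootPoly fun i => Complex.exp (ζ i e)).coeff j.1) e := by
    refine AnalyticAt.mul ?_ (analyticAt_coeff_prod _ (fun i => ?_) _)
    · exact (Complex.ofRealCLM.analyticAt _).comp hτ.rexp
    · exact (analyticAt_cexp.restrictScalars (𝕜 := ℝ)).comp (hζ i)
  simp only [classCoord, normalForm_rootClass]
  by_cases hj : j.2 = 0
  · simp only [hj, if_true]
    exact (Complex.reCLM.analyticAt _).comp h
  · simp only [hj, if_false]
    exact (Complex.imCLM.analyticAt _).comp h

/-- In exponential coordinates, reflection of roots is a linear map. -/
theorem flipRoots_expRoots {N : ℕ} (S : Finset (Fin N)) (e : ℝ × (Fin N → ℂ)) :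
    flipRoots S (expRoots e) = expRoots (e.1 + ∑ i ∈ S, (e.2 i).re,
      fun i => if i ∈ S then -conj (e.2 i) else e.2 i) := by
  refine Subtype.ext (Prod.ext ?_ (funext fun i => ?_))
  · simp [flipRoots, expRoots, Real.exp_add, Real.exp_sum, Complex.norm_exp]
  · by_cases h : i ∈ S
    · simp [flipRoots, expRoots, flipVec, h, Complex.exp_neg, Complex.exp_conj]
    · simp [flipRoots, expRoots, flipVec, h]

theorem analyticAt_pairCoord {N : ℕ} (S : Finset (Fin N))
    (j : (Fin (N + 1) × Fin 2) ⊕ (Fin (N + 1) × Fin 2)) (e : ℝ × (Fin N → ℂ)) :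
    AnalyticAt ℝ (fun e => pairCoord (pairOfRoots S (expRoots e)) j) e := by
  have h1 : AnalyticAt ℝ (fun e : ℝ × (Fin N → ℂ) => e.1) e := analyticAt_fst
  have h2 : ∀ i, AnalyticAt ℝ (fun e : ℝ × (Fin N → ℂ) => e.2 i) e := fun i =>
    ((ContinuousLinearMap.proj (R := ℝ) (φ := fun _ : Fin N => ℂ) i).analyticAt _).comp
      analyticAt_snd
  rcases j with j | j
  · exact analyticAt_classCoord h1 h2 j
  · simp only [pairCoord, pairOfRoots, flipRoots_expRoots, Sum.elim_inr]
    refine analyticAt_classCoord (h1.add ?_) (fun i => ?_) j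
    · exact Finset.analyticAt_fun_sum _ fun i _ => (Complex.reCLM.analyticAt _).comp (h2 i)
    · by_cases hi : i ∈ S
      · simp only [if_pos hi]
        exact ((Complex.conjCLE.toContinuousLinearMap.analyticAt _).comp (h2 i)).neg
      · simpa only [if_neg hi] using h2 i

theorem isIrreducible_incidenceComponent {N k : ℕ} (hk : k ≤ N) :
    @IsIrreducible _ (zariskiTopology (pairCoord (N := N))) (incidenceComponent N k) := by
  obtain ⟨S, rfl⟩ := exists_card_eq_of_le hk
  rw [incidenceComponent_eq_range, ← expRoots_surjective.range_comp]
  exact isIrreducible_range_of_analytic (analyticAt_pairCoord S)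

theorem isIrreducible_incidenceComponent_subtype {N k : ℕ} (hk : k ≤ N) :
    @IsIrreducible _ (zariskiTopology fun p : incidence N => pairCoord p.1)
      {p : incidence N | p.1 ∈ incidenceComponent N k} := by
  obtain ⟨S, rfl⟩ := exists_card_eq_of_le hk
  have : {p : incidence N | p.1 ∈ incidenceComponent N S.card} =
      Set.range fun e => (⟨pairOfRoots S (expRoots e), pairOfRoots_mem_incidence S _⟩ :
        incidence N) := by
    ext ⟨p, hp⟩
    rw [Set.mem_ofPred_eq, incidenceComponent_eq_range, ← expRoots_surjective.range_comp]
    simp [Subtype.ext_iff]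
  rw [this]
  exact isIrreducible_range_of_analytic (c := fun p : incidence N => pairCoord p.1)
    (analyticAt_pairCoord S)

/-! ### Common factors of polynomials -/

/-- The polynomials `f` and `g` satisfy a non-trivial linear relation with coefficients of degree at
most `k`. For `f` and `g` of degree `N` this means that they have a common divisor of degree at
least `N - k`. -/
def HasCofactors (k : ℕ) (f g : ℂ[X]) : Prop :=
  ∃ u v : ℂ[X], (u ≠ 0 ∨ v ≠ 0) ∧ u.natDegree ≤ k ∧ v.natDegree ≤ k ∧ u * f + v * g = 0

theorem HasCofactors.C_mul_right {k : ℕ} {f g : ℂ[X]} (h : HasCofactors k f g) {a : ℂ}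
    (ha : a ≠ 0) : HasCofactors k f (C a * g) := by
  obtain ⟨u, v, huv, hu, hv, h⟩ := h
  refine ⟨u, C a⁻¹ * v, huv.imp_right fun hv => mul_ne_zero (C_ne_zero.2 (inv_ne_zero ha)) hv, hu,
    (natDegree_C_mul_le _ _).trans hv, ?_⟩
  rw [← h, mul_mul_mul_comm, ← C_mul, inv_mul_cancel₀ ha, C_1, one_mul]

theorem coeff_sum_C_mul_X_pow {n : ℕ} (w : Fin n → ℂ) (r : ℕ) :
    (∑ i, C (w i) * X ^ (i : ℕ)).coeff r = ∑ i : Fin n, if r = i then w i else 0 := by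
  simp only [finsetSum_coeff, coeff_C_mul_X_pow]

theorem coeff_sum_C_mul_X_pow_fin {n : ℕ} (w : Fin n → ℂ) (r : Fin n) :
    (∑ i, C (w i) * X ^ (i : ℕ)).coeff r = w r := by
  simp [Fin.val_inj]

theorem natDegree_sum_C_mul_X_pow_le {n : ℕ} (w : Fin (n + 1) → ℂ) :
    (∑ i, C (w i) * X ^ (i : ℕ)).natDegree ≤ n :=
  natDegree_sum_le_of_forall_le _ _ fun i _ =>
    (natDegree_C_mul_X_pow_le _ _).trans (Nat.lt_succ_iff.1 i.2)

/-- The matrix of the map `(u, v) ↦ u * f + v * g` on pairs of polynomials of degree at most `k`, a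
rectangular Sylvester matrix. -/
noncomputable def cofactorMatrix (N k : ℕ) (f g : ℂ[X]) :
    Matrix (Fin (N + k + 1)) (Fin (k + 1) ⊕ Fin (k + 1)) ℂ :=
  Matrix.of fun r => Sum.elim (fun i => (X ^ (i : ℕ) * f).coeff r)
    (fun i => (X ^ (i : ℕ) * g).coeff r)

theorem cofactorMatrix_mulVec (N k : ℕ) (f g : ℂ[X]) (w : Fin (k + 1) ⊕ Fin (k + 1) → ℂ)
    (r : Fin (N + k + 1)) :
    (cofactorMatrix N k f g).mulVec w r = ((∑ i, C (w (Sum.inl i)) * X ^ (i : ℕ)) * f +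
      (∑ i, C (w (Sum.inr i)) * X ^ (i : ℕ)) * g).coeff r := by
  simp only [Matrix.mulVec, dotProduct, Fintype.sum_sum_type, cofactorMatrix, Matrix.of_apply,
    Sum.elim_inl, Sum.elim_inr, coeff_add, Finset.sum_mul, finsetSum_coeff, mul_assoc, coeff_C_mul]
  simp only [mul_comm]

theorem hasCofactors_iff {N k : ℕ} {f g : ℂ[X]} (hf : f.natDegree ≤ N) (hg : g.natDegree ≤ N) :
    HasCofactors k f g ↔ ∃ w ≠ 0, (cofactorMatrix N k f g).mulVec w = 0 := by
  constructor
  · rintro ⟨u, v, huv, hu, hv, h⟩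
    refine ⟨Sum.elim (fun i => u.coeff i) (fun i => v.coeff i), fun h0 => ?_, funext fun r => ?_⟩
    · have hu0 : u = 0 := by
        rw [← sum_C_coeff_mul_X_pow hu]
        exact Finset.sum_eq_zero fun i _ => by
          have : u.coeff i = 0 := congrFun h0 (Sum.inl i)
          rw [this, C_0, zero_mul]
      have hv0 : v = 0 := by
        rw [← sum_C_coeff_mul_X_pow hv]
        exact Finset.sum_eq_zero fun i _ => by
          have : v.coeff i = 0 := congrFun h0 (Sum.inr i)
          rw [this, C_0, zero_mul]
      exact huv.elim (fun h => h hu0) fun h => h hv0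
    · rw [cofactorMatrix_mulVec]
      simp only [Sum.elim_inl, Sum.elim_inr]
      rw [sum_C_coeff_mul_X_pow hu, sum_C_coeff_mul_X_pow hv, h]
      simp
  · rintro ⟨w, hw, h⟩
    refine ⟨_, _, ?_, natDegree_sum_C_mul_X_pow_le fun i => w (Sum.inl i),
      natDegree_sum_C_mul_X_pow_le fun i => w (Sum.inr i), ?_⟩
    · by_contra! hcon
      refine hw (funext fun j => ?_)
      rcases j with i | i
      · have := congrArg (fun p => coeff p i) hcon.1
        exact (coeff_sum_C_mul_X_pow_fin (fun i => w (Sum.inl i)) i).symm.trans this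
      · have := congrArg (fun p => coeff p i) hcon.2
        exact (coeff_sum_C_mul_X_pow_fin (fun i => w (Sum.inr i)) i).symm.trans this
    · ext r
      by_cases hr : r < N + k + 1
      · have := congrFun h ⟨r, hr⟩
        rw [cofactorMatrix_mulVec] at this
        simpa using this
      · refine coeff_eq_zero_of_natDegree_lt (lt_of_le_of_lt ?_ (not_lt.1 hr))
        refine natDegree_add_le_of_degree_le ?_ ?_
        · refine natDegree_mul_le.trans ?_
          have := natDegree_sum_C_mul_X_pow_le fun i => w (Sum.inl i)
          omega
        · refine natDegree_mul_le.trans ?_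
          have := natDegree_sum_C_mul_X_pow_le fun i => w (Sum.inr i)
          omega

theorem IsRegularFun.coeff_X_pow_mul {A ι : Type} {c : A → ι → ℝ} {n : ℕ} {f : A → Fin n → ℂ}
    (h : ∀ i, IsRegularFun c fun a => f a i) (i r : ℕ) :
    IsRegularFun c fun a => (X ^ i * ∑ j, C (f a j) * X ^ (j : ℕ)).coeff r := by
  simp only [coeff_X_pow_mul', coeff_sum_C_mul_X_pow]
  by_cases hi : i ≤ r
  · simp only [if_pos hi]
    refine IsRegularFun.sum _ fun j => ?_
    by_cases hj : r - i = j
    · simpa only [if_pos hj] using h j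
    · simpa only [if_neg hj] using IsRegularFun.const 0
  · simpa only [if_neg hi] using IsRegularFun.const 0

theorem isClosed_hasCofactors {A ι : Type} {c : A → ι → ℝ} {N : ℕ} (k : ℕ)
    {f g : A → Fin (N + 1) → ℂ} (hf : ∀ i, IsRegularFun c fun a => f a i)
    (hg : ∀ i, IsRegularFun c fun a => g a i) :
    IsClosed[zariskiTopology c] {a | HasCofactors k (∑ j, C (f a j) * X ^ (j : ℕ))
      (∑ j, C (g a j) * X ^ (j : ℕ))} := by
  simp only [hasCofactors_iff (natDegree_sum_C_mul_X_pow_le _) (natDegree_sum_C_mul_X_pow_le _)]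
  refine isClosed_exists_mulVec_eq_zero fun r j => ?_
  rcases j with i | i
  · exact IsRegularFun.coeff_X_pow_mul hf i r
  · exact IsRegularFun.coeff_X_pow_mul hg i r

/-! ### Common roots of the two signals of a pair -/

/-- The Fourier polynomial of the normal form. -/
noncomputable def normalPoly {N : ℕ} (z : SignalClass N) : ℂ[X] :=
  ∑ n, C (normalForm z n) * X ^ (n : ℕ)

theorem normalPoly_rootClass {N : ℕ} (q : RootData N) :
    normalPoly (rootClass q) = C (q.1.1 : ℂ) * invRootPoly q.1.2 := by
  rw [normalPoly, normalForm_rootClass, ← fourierPoly_signalOfRoots, fourierPoly]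

/-- The coefficients of the normal form of the reflected signal are not polynomial in the
coordinates, but become so after multiplication by a suitable factor. -/
theorem exists_reflect_normalPoly_eq {N : ℕ} (z : SignalClass N) :
    ∃ a ≠ 0, normalPoly (reflectClass z) =
      C a * ∑ n : Fin (N + 1), C (conj (normalForm z n.rev)) * X ^ (n : ℕ) := by
  obtain ⟨q, rfl⟩ := rootClass_surjective z
  set x := reflectSignal (signalOfRoots q) with hx
  refine ⟨conj (x.1 0) / (‖x.1 0‖ : ℂ), div_ne_zero (by simpa using x.2.1) (by simpa using x.2.1),
    ?_⟩
  rw [Finset.mul_sum, normalForm_rootClass]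
  refine Finset.sum_congr rfl fun n _ => ?_
  rw [← mul_assoc, ← C_mul]
  rfl

theorem isClosed_hasCofactors_normalPoly (N k : ℕ) :
    IsClosed[zariskiTopology (pairCoord (N := N))]
      {p | HasCofactors k (normalPoly p.1) (normalPoly p.2)} :=
  isClosed_hasCofactors k isRegularFun_normalForm_fst isRegularFun_normalForm_snd

theorem isClosed_hasCofactors_normalPoly_reflect (N k : ℕ) :
    IsClosed[zariskiTopology (pairCoord (N := N))]
      {p | HasCofactors k (normalPoly p.1) (normalPoly (reflectClass p.2))} := by
  have : {p : SignalClass N × SignalClass N |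
      HasCofactors k (normalPoly p.1) (normalPoly (reflectClass p.2))} =
      {p | HasCofactors k (normalPoly p.1)
        (∑ n : Fin (N + 1), C (conj (normalForm p.2 n.rev)) * X ^ (n : ℕ))} := by
    ext p
    obtain ⟨a, ha, h⟩ := exists_reflect_normalPoly_eq p.2
    rw [Set.mem_ofPred_eq, Set.mem_ofPred_eq, h]
    refine ⟨fun h' => ?_, fun h' => h'.C_mul_right ha⟩
    have := h'.C_mul_right (inv_ne_zero ha)
    rwa [← mul_assoc, ← C_mul, inv_mul_cancel₀ ha, C_1, one_mul] at this
  rw [this]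
  exact isClosed_hasCofactors k isRegularFun_normalForm_fst fun n =>
    (isRegularFun_normalForm_snd n.rev).conjugate

theorem hasCofactors_pairOfRoots {N : ℕ} (S : Finset (Fin N)) (q : RootData N) :
    HasCofactors S.card (normalPoly (pairOfRoots S q).1) (normalPoly (pairOfRoots S q).2) := by
  have hdeg : ∀ (a : ℂ) (β : Fin N → ℂ),
      (C a * ∏ i ∈ S, (1 - C (β i) * X)).natDegree ≤ S.card := fun a β => by
    refine (natDegree_C_mul_le _ _).trans ((natDegree_prod_le _ _).trans ?_)
    refine (Finset.sum_le_card_nsmul _ _ 1 fun i _ => ?_).trans (by simp)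
    compute_degree
  have hsplit : ∀ β : Fin N → ℂ, invRootPoly β =
      (∏ i ∈ S, (1 - C (β i) * X)) * ∏ i ∈ Sᶜ, (1 - C (β i) * X) := fun β =>
    (Finset.prod_mul_prod_compl S _).symm
  have hcompl : ∏ i ∈ Sᶜ, (1 - C ((flipRoots S q).1.2 i) * X) =
      ∏ i ∈ Sᶜ, (1 - C (q.1.2 i) * X) := Finset.prod_congr rfl fun i hi => by
    simp [flipRoots, flipVec, Finset.mem_compl.1 hi]
  refine ⟨C ((flipRoots S q).1.1 : ℂ) * ∏ i ∈ S, (1 - C ((flipRoots S q).1.2 i) * X),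
    C (-q.1.1 : ℂ) * ∏ i ∈ S, (1 - C (q.1.2 i) * X), Or.inr ?_, hdeg _ _, hdeg _ _, ?_⟩
  · intro h0
    have := congrArg (eval 0) h0
    simp only [eval_mul, eval_C, eval_prod, eval_sub, eval_one, eval_X, mul_zero, sub_zero,
      Finset.prod_const_one, mul_one, eval_zero, neg_eq_zero, Complex.ofReal_eq_zero] at this
    exact q.2.1.ne' this
  · simp only [pairOfRoots, normalPoly_rootClass]
    rw [hsplit q.1.2, hsplit (flipRoots S q).1.2, hcompl, C_neg]
    ring

/-- For roots in general position, the common roots of the two signals are those that are not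
reflected. -/
theorem card_le_of_hasCofactors_genericRoots {N k : ℕ} (S : Finset (Fin N))
    (h : HasCofactors k (normalPoly (pairOfRoots S (genericRoots N)).1)
      (normalPoly (pairOfRoots S (genericRoots N)).2)) : S.card ≤ k := by
  obtain ⟨u, v, huv, hu, -, h⟩ := h
  simp only [pairOfRoots, normalPoly_rootClass] at h
  have hα : ∀ j : Fin N, (genericRoots N).1.2 j = ((j + 2 : ℝ) : ℂ) := fun j => by
    simp [genericRoots]
  -- at a reflected root the second polynomial vanishes and the first does not
  have hroot : ∀ i ∈ S, u.eval ((genericRoots N).1.2 i) = 0 := by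
    intro i hi
    have h1 := congrArg (eval ((genericRoots N).1.2 i)) h
    have h2 : (invRootPoly (flipRoots S (genericRoots N)).1.2).eval ((genericRoots N).1.2 i) = 0 := by
      rw [eval_invRootPoly]
      refine Finset.prod_eq_zero (Finset.mem_univ i) ?_
      have h3 : (genericRoots N).1.2 i ≠ 0 := (genericRoots N).2.2 i
      simp only [flipRoots, flipVec, if_pos hi]
      rw [hα] at h3 ⊢
      rw [Complex.conj_ofReal, inv_mul_cancel₀ h3, sub_self]
    have h4 : (invRootPoly (genericRoots N).1.2).eval ((genericRoots N).1.2 i) ≠ 0 := by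
      rw [eval_invRootPoly, Finset.prod_ne_zero_iff]
      intro j _ h5
      rw [hα, hα, sub_eq_zero] at h5
      have h6 : (1 : ℝ) = (j + 2) * (i + 2) := by exact_mod_cast h5
      nlinarith [(i : ℕ).cast_nonneg (α := ℝ), (j : ℕ).cast_nonneg (α := ℝ)]
    have h7 : (((genericRoots N).1.1 : ℝ) : ℂ) ≠ 0 :=
      Complex.ofReal_ne_zero.2 (genericRoots N).2.1.ne'
    rw [eval_add, eval_mul, eval_mul, eval_mul, eval_mul, h2, mul_zero, mul_zero, add_zero, eval_C,
      eval_zero] at h1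
    exact (mul_eq_zero.1 h1).resolve_right (mul_ne_zero h7 h4)
  have hu0 : u ≠ 0 := by
    rintro rfl
    have hne : invRootPoly (flipRoots S (genericRoots N)).1.2 ≠ 0 := fun h0 => by
      simpa [h0] using coeff_zero_invRootPoly (flipRoots S (genericRoots N)).1.2
    have h7 : (((flipRoots S (genericRoots N)).1.1 : ℝ) : ℂ) ≠ 0 :=
      Complex.ofReal_ne_zero.2 (flipRoots S (genericRoots N)).2.1.ne'
    rw [zero_mul, zero_add] at h
    exact huv.elim (fun h => h rfl) fun hv =>
      mul_ne_zero hv (mul_ne_zero (C_ne_zero.2 h7) hne) h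
  have hinj : Function.Injective (genericRoots N).1.2 := fun i j hij => by
    rw [hα, hα, Complex.ofReal_inj] at hij
    exact Fin.ext (by exact_mod_cast add_right_cancel hij)
  rw [← Finset.card_image_of_injective S hinj]
  refine (card_le_degree_of_subset_roots fun z hz => ?_).trans hu
  obtain ⟨i, hi, rfl⟩ := Finset.mem_image.1 hz
  exact (mem_roots hu0).2 (hroot i hi)

theorem closure_incidenceComponent_subset {N k : ℕ} {Z : Set (SignalClass N × SignalClass N)}
    (hZ : IsClosed[zariskiTopology pairCoord] Z) (h : incidenceComponent N k ⊆ Z) :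
    closure[zariskiTopology fun p : incidence N => pairCoord p.1]
      {p : incidence N | p.1 ∈ incidenceComponent N k} ⊆ {p : incidence N | p.1 ∈ Z} := by
  have hsub : {p : incidence N | p.1 ∈ incidenceComponent N k} ⊆ {p : incidence N | p.1 ∈ Z} :=
    fun p hp => h hp
  obtain ⟨F, hF⟩ := isClosed_zariskiTopology_iff.1 hZ
  have hc : IsClosed[zariskiTopology fun p : incidence N => pairCoord p.1]
      {p : incidence N | p.1 ∈ Z} := isClosed_zariskiTopology_iff.2 ⟨F, by rw [hF]; rfl⟩
  exact @closure_minimal _ (zariskiTopology fun p : incidence N => pairCoord p.1) _ _ hsub hc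

/-- No piece of the incidence set lies in the Zariski closure of another one: the number of common
roots of `x` and `y` would drop, or that of `x` and the reflection of `y`. -/
theorem eq_of_incidenceComponent_subset_closure {N j k : ℕ} (hj : j ≤ N) (hk : k ≤ N)
    (h : {p : incidence N | p.1 ∈ incidenceComponent N j} ⊆
      closure[zariskiTopology fun p : incidence N => pairCoord p.1]
        {p : incidence N | p.1 ∈ incidenceComponent N k}) : j = k := by
  obtain ⟨S, rfl⟩ := exists_card_eq_of_le hj
  have hmem : ∀ Z, IsClosed[zariskiTopology pairCoord] Z → incidenceComponent N k ⊆ Z →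
      pairOfRoots S (genericRoots N) ∈ Z := fun Z hZ hkZ =>
    (h.trans (closure_incidenceComponent_subset hZ hkZ))
      (show ⟨_, pairOfRoots_mem_incidence S _⟩ ∈ _ from
        pairOfRoots_mem_incidenceComponent S (genericRoots N))
  have h1 : S.card ≤ k := by
    refine card_le_of_hasCofactors_genericRoots S
      (hmem _ (isClosed_hasCofactors_normalPoly N k) fun z hz => ?_)
    obtain ⟨T, q, rfl, rfl⟩ := mem_incidenceComponent_iff.1 hz
    exact hasCofactors_pairOfRoots T q
  have h2 : Sᶜ.card ≤ N - k := by
    refine card_le_of_hasCofactors_genericRoots Sᶜ ?_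
    rw [← reflectSecond_pairOfRoots]
    refine hmem _ (isClosed_hasCofactors_normalPoly_reflect N (N - k)) fun z hz => ?_
    obtain ⟨T, q, hT, hz'⟩ :=
      mem_incidenceComponent_iff.1 (reflectSecond_mem_incidenceComponent hz)
    have := hasCofactors_pairOfRoots T q
    rwa [hT, hz'] at this
  rw [Finset.card_compl, Fintype.card_fin] at h2
  omega

/-! ### Basic semi-algebraic sets -/

/-- The solution set of a finite system of polynomial equations and strict inequalities. -/
def IsBasicSemialgebraic {ι : Type} (S : Set (ι → ℝ)) : Prop :=
  ∃ F G : Finset (MvPolynomial ι ℝ),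
    S = {x | (∀ f ∈ F, MvPolynomial.eval x f = 0) ∧ ∀ g ∈ G, 0 < MvPolynomial.eval x g}

namespace IsBasicSemialgebraic

variable {ι κ : Type} {S S' : Set (ι → ℝ)}

theorem isSemialgebraic (h : IsBasicSemialgebraic S) : IsSemialgebraic S := by
  obtain ⟨F, G, rfl⟩ := h
  refine ⟨{_}, Set.finite_singleton _, (Set.sUnion_singleton _).symm, ?_⟩
  rintro _ rfl
  refine ⟨∑ f ∈ F, f ^ 2, G, ?_⟩
  ext x
  simp only [Set.mem_ofPred_eq, map_sum, map_pow]
  rw [Finset.sum_eq_zero_iff_of_nonneg fun f _ => sq_nonneg _]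
  simp only [sq_eq_zero_iff]

theorem inter (h : IsBasicSemialgebraic S) (h' : IsBasicSemialgebraic S') :
    IsBasicSemialgebraic (S ∩ S') := by
  classical
  obtain ⟨F, G, rfl⟩ := h
  obtain ⟨F', G', rfl⟩ := h'
  refine ⟨F ∪ F', G ∪ G', ?_⟩
  ext x
  simp only [Set.mem_inter_iff, Set.mem_ofPred_eq, Finset.mem_union, or_imp, forall_and]
  tauto

theorem zeros [Fintype κ] (p : κ → MvPolynomial ι ℝ) :
    IsBasicSemialgebraic {x | ∀ i, MvPolynomial.eval x (p i) = 0} := by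
  classical
  exact ⟨Finset.univ.image p, ∅, by ext x; simp⟩

theorem pos (p : MvPolynomial ι ℝ) : IsBasicSemialgebraic {x | 0 < MvPolynomial.eval x p} :=
  ⟨∅, {p}, by ext x; simp⟩

theorem preimage_comp (h : IsBasicSemialgebraic S) (σ : ι → κ) :
    IsBasicSemialgebraic {x : κ → ℝ | x ∘ σ ∈ S} := by
  classical
  obtain ⟨F, G, rfl⟩ := h
  refine ⟨F.image (MvPolynomial.rename σ), G.image (MvPolynomial.rename σ), ?_⟩
  ext x
  simp [MvPolynomial.eval_rename]

end IsBasicSemialgebraic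

theorem isBasicSemialgebraic_eq {ι κ : Type} [Fintype κ] (σ τ : κ → ι) :
    IsBasicSemialgebraic {x : ι → ℝ | x ∘ σ = x ∘ τ} := by
  convert IsBasicSemialgebraic.zeros fun i => (MvPolynomial.X (σ i) - MvPolynomial.X (τ i) :
    MvPolynomial ι ℝ) using 1
  ext x
  simp [funext_iff, sub_eq_zero]

/-! ### Semi-algebraic description of the space of signals -/

theorem exists_normalForm_zero_eq {N : ℕ} (z : SignalClass N) :
    ∃ r : ℝ, 0 < r ∧ normalForm z 0 = r := by
  obtain ⟨q, rfl⟩ := rootClass_surjective z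
  exact ⟨q.1.1, q.2.1, by rw [normalForm_rootClass, signalOfRoots_zero]⟩

theorem normalForm_last_ne_zero {N : ℕ} (z : SignalClass N) : normalForm z (Fin.last N) ≠ 0 := by
  obtain ⟨q, rfl⟩ := rootClass_surjective z
  rw [normalForm_rootClass]
  exact (signalOfRoots q).2.2

theorem range_classCoord (N : ℕ) : Set.range (classCoord (N := N)) =
    {v | v (0, 1) = 0 ∧ 0 < v (0, 0) ∧ 0 < v (Fin.last N, 0) ^ 2 + v (Fin.last N, 1) ^ 2} := by
  ext v
  constructor
  · rintro ⟨z, rfl⟩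
    obtain ⟨r, hr, h⟩ := exists_normalForm_zero_eq z
    have hN := Complex.normSq_pos.2 (normalForm_last_ne_zero z)
    rw [Complex.normSq_apply] at hN
    simpa [classCoord, h, hr, sq] using hN
  · rintro ⟨h0, hr, hN⟩
    have hx0 : (⟨v (0, 0), v (0, 1)⟩ : ℂ) = (v (0, 0) : ℂ) := Complex.ext rfl h0
    let x : Signal N := ⟨fun n => ⟨v (n, 0), v (n, 1)⟩,
      hx0.trans_ne (Complex.ofReal_ne_zero.2 hr.ne'), fun h => by
        simp only [Complex.ext_iff, Complex.zero_re, Complex.zero_im] at h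
        simp [h.1, h.2] at hN⟩
    refine ⟨toClass x, funext fun ⟨n, j⟩ => ?_⟩
    rw [classCoord, normalForm_toClass_of_pos (x := x) hr hx0]
    fin_cases j <;> simp [x]

theorem isBasicSemialgebraic_range_classCoord (N : ℕ) :
    IsBasicSemialgebraic (Set.range (classCoord (N := N))) := by
  rw [range_classCoord]
  convert (IsBasicSemialgebraic.zeros fun _ : Unit =>
    (MvPolynomial.X (0, 1) : MvPolynomial (Fin (N + 1) × Fin 2) ℝ)).inter
    ((IsBasicSemialgebraic.pos (MvPolynomial.X (0, 0))).inter (IsBasicSemialgebraic.pos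
      (MvPolynomial.X (Fin.last N, 0) ^ 2 + MvPolynomial.X (Fin.last N, 1) ^ 2))) using 1
  ext v
  simp

/-- A piece of the incidence set that is the graph of a continuous semi-algebraic map is isomorphic
to the space of signals. -/
theorem semialgebraicallyIsomorphic_of_graph {N : ℕ} {φ : SignalClass N → SignalClass N}
    (hφ : Continuous φ) {s : Set (SignalClass N × SignalClass N)} (hs : ∀ z, z ∈ s ↔ z.2 = φ z.1)
    (h : IsBasicSemialgebraic (Set.range fun z => pairCoord (z, φ z))) :
    SemialgebraicallyIsomorphic (classCoord (N := N)) fun p : s => pairCoord p.1 := by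
  refine ⟨(isBasicSemialgebraic_range_classCoord N).isSemialgebraic, ?_, ?_⟩
  · convert h.isSemialgebraic using 1
    ext v
    constructor
    · rintro ⟨⟨⟨x, y⟩, hz⟩, rfl⟩
      obtain rfl : y = φ x := (hs _).1 hz
      exact ⟨x, rfl⟩
    · rintro ⟨x, rfl⟩
      exact ⟨⟨(x, φ x), (hs _).2 rfl⟩, rfl⟩
  · refine ⟨{ toFun := fun x => ⟨(x, φ x), (hs _).2 rfl⟩
              invFun := fun p => p.1.1
              left_inv := fun x => rfl
              right_inv := fun p => Subtype.ext (Prod.ext rfl ((hs _).1 p.2).symm)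
              continuous_toFun := (continuous_id.prodMk hφ).subtype_mk _
              continuous_invFun := continuous_fst.comp continuous_subtype_val }, ?_⟩
    refine IsBasicSemialgebraic.isSemialgebraic ?_
    convert (h.preimage_comp (κ := (Fin (N + 1) × Fin 2) ⊕ _) Sum.inr).inter
      (isBasicSemialgebraic_eq Sum.inl (Sum.inr ∘ Sum.inl)) using 1
    ext w
    constructor
    · rintro ⟨x, rfl⟩
      exact ⟨⟨x, rfl⟩, rfl⟩
    · rintro ⟨⟨x, hx⟩, hw⟩
      refine ⟨x, funext fun i => ?_⟩
      rcases i with i | i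
      · exact (congrFun hx (Sum.inl i)).trans (congrFun hw i).symm
      · exact congrFun hx i

theorem semialgebraicallyIsomorphic_incidenceComponent_zero (N : ℕ) :
    SemialgebraicallyIsomorphic (classCoord (N := N))
      fun p : incidenceComponent N 0 => pairCoord p.1 := by
  refine semialgebraicallyIsomorphic_of_graph (φ := fun x => x) continuous_id
    (fun z => mem_incidenceComponent_zero_iff) ?_
  convert ((isBasicSemialgebraic_range_classCoord N).preimage_comp Sum.inl).inter
    (isBasicSemialgebraic_eq Sum.inl Sum.inr) using 1
  ext w
  constructor
  · rintro ⟨x, rfl⟩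
    exact ⟨⟨x, rfl⟩, rfl⟩
  · rintro ⟨⟨x, hx⟩, hw⟩
    refine ⟨x, funext fun i => ?_⟩
    rcases i with i | i
    · exact congrFun hx i
    · exact (congrFun hx i).trans (congrFun hw i)

theorem normalForm_reflectClass {N : ℕ} (z : SignalClass N) (n : Fin (N + 1)) :
    normalForm (reflectClass z) n = normalForm z (Fin.last N) / (‖normalForm z (Fin.last N)‖ : ℂ) *
      conj (normalForm z n.rev) := by
  obtain ⟨q, rfl⟩ := rootClass_surjective z
  rw [normalForm_rootClass]
  change conj (conj ((signalOfRoots q).1 (Fin.rev 0))) /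
    (‖conj ((signalOfRoots q).1 (Fin.rev 0))‖ : ℂ) * conj ((signalOfRoots q).1 n.rev) = _
  rw [Complex.conj_conj, Complex.norm_conj, Fin.rev_zero]

theorem norm_mul_normalForm_reflectClass {N : ℕ} (z : SignalClass N) (n : Fin (N + 1)) :
    (‖normalForm z (Fin.last N)‖ : ℂ) * normalForm (reflectClass z) n =
      normalForm z (Fin.last N) * conj (normalForm z n.rev) := by
  have h : (‖normalForm z (Fin.last N)‖ : ℂ) ≠ 0 := by
    simpa using normalForm_last_ne_zero z
  rw [normalForm_reflectClass, ← mul_assoc, mul_div_cancel₀ _ h]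

theorem normalForm_reflectClass_zero {N : ℕ} (z : SignalClass N) :
    normalForm (reflectClass z) 0 = ‖normalForm z (Fin.last N)‖ := by
  have h : (‖normalForm z (Fin.last N)‖ : ℂ) ≠ 0 := by
    simpa using normalForm_last_ne_zero z
  refine mul_left_cancel₀ h ?_
  rw [norm_mul_normalForm_reflectClass, Fin.rev_zero, Complex.mul_conj', sq]

/-- The normal form of the reflected signal is characterised by polynomial equations. -/
theorem eq_normalForm_reflectClass {N : ℕ} {z : SignalClass N} {r : ℝ} {y : Fin (N + 1) → ℂ}
    (hr : 0 < r) (hy0 : (y 0).re = r)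
    (h : ∀ n, (r : ℂ) * y n = normalForm z (Fin.last N) * conj (normalForm z n.rev)) :
    y = normalForm (reflectClass z) := by
  have h0 : r = ‖normalForm z (Fin.last N)‖ := by
    have h1 := congrArg Complex.re (h 0)
    rw [Fin.rev_zero, Complex.mul_conj', Complex.re_ofReal_mul, hy0, ← Complex.ofReal_pow,
      Complex.ofReal_re, ← sq] at h1
    exact (pow_left_inj₀ hr.le (norm_nonneg _) two_ne_zero).1 h1
  funext n
  refine mul_left_cancel₀ (Complex.ofReal_ne_zero.2 hr.ne') ?_
  rw [h n, ← norm_mul_normalForm_reflectClass, ← h0]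

theorem semialgebraicallyIsomorphic_incidenceComponent_self (N : ℕ) :
    SemialgebraicallyIsomorphic (classCoord (N := N))
      fun p : incidenceComponent N N => pairCoord p.1 := by
  refine semialgebraicallyIsomorphic_of_graph continuous_reflectClass
    (fun z => mem_incidenceComponent_self_iff) ?_
  -- real and imaginary part of the equations `y[0] y[n] = x[N] conj x[N - n]`
  let a : Fin (N + 1) × Fin 2 → MvPolynomial ((Fin (N + 1) × Fin 2) ⊕ (Fin (N + 1) × Fin 2)) ℝ :=
    fun i => MvPolynomial.X (Sum.inl i)
  let b : Fin (N + 1) × Fin 2 → MvPolynomial ((Fin (N + 1) × Fin 2) ⊕ (Fin (N + 1) × Fin 2)) ℝ :=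
    fun i => MvPolynomial.X (Sum.inr i)
  convert ((isBasicSemialgebraic_range_classCoord N).preimage_comp Sum.inl).inter
    ((IsBasicSemialgebraic.pos (b (0, 0))).inter
      ((IsBasicSemialgebraic.zeros fun n => b (0, 0) * b (n, 0) -
        (a (Fin.last N, 0) * a (n.rev, 0) + a (Fin.last N, 1) * a (n.rev, 1))).inter
      (IsBasicSemialgebraic.zeros fun n => b (0, 0) * b (n, 1) -
        (a (Fin.last N, 1) * a (n.rev, 0) - a (Fin.last N, 0) * a (n.rev, 1))))) using 1
  ext w
  simp only [Set.mem_inter_iff, Set.mem_ofPred_eq, a, b, map_sub, map_add, map_mul,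
    MvPolynomial.eval_X, sub_eq_zero]
  constructor
  · rintro ⟨x, rfl⟩
    have h0 := normalForm_reflectClass_zero x
    have hn : 0 < ‖normalForm x (Fin.last N)‖ := norm_pos_iff.2 (normalForm_last_ne_zero x)
    refine ⟨⟨x, rfl⟩, ?_, fun n => ?_, fun n => ?_⟩
    · simpa [pairCoord, classCoord, h0] using hn
    · have := congrArg Complex.re (norm_mul_normalForm_reflectClass x n)
      simpa [pairCoord, classCoord, h0] using this
    · have := congrArg Complex.im (norm_mul_normalForm_reflectClass x n)
      simp [pairCoord, classCoord, h0] at this ⊢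
      linarith
  · rintro ⟨⟨x, hx⟩, hpos, hre, him⟩
    have hx' : ∀ i, w (Sum.inl i) = classCoord x i := fun i => (congrFun hx i).symm
    have hy := eq_normalForm_reflectClass (z := x)
      (y := fun n => ⟨w (Sum.inr (n, 0)), w (Sum.inr (n, 1))⟩) hpos rfl fun n => by
        apply Complex.ext
        · simpa [hx', classCoord] using hre n
        · have := him n
          simp [hx', classCoord] at this ⊢
          linarith
    refine ⟨x, funext fun i => ?_⟩
    rcases i with i | ⟨n, j⟩
    · exact (hx' i).symm
    · simp only [pairCoord, Sum.elim_inr, classCoord, ← hy]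
      fin_cases j <;> simp

/-! ### Trivial ambiguities -/

theorem isClosed_incidenceComponent_zero (N : ℕ) :
    IsClosed[zariskiTopology (pairCoord (N := N))] (incidenceComponent N 0) := by
  have : incidenceComponent N 0 = ⋂ n, {p | normalForm p.2 n - normalForm p.1 n = 0} := by
    ext p
    simp only [mem_incidenceComponent_zero_iff, Set.mem_iInter, Set.mem_ofPred_eq, sub_eq_zero,
      ← normalForm_injective.eq_iff, funext_iff]
  rw [this]
  exact @isClosed_iInter _ _ (zariskiTopology pairCoord) _ fun n =>
    ((isRegularFun_normalForm_snd n).sub (isRegularFun_normalForm_fst n)).isClosed_zero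

theorem isClosed_incidenceComponent_self (N : ℕ) :
    IsClosed[zariskiTopology (pairCoord (N := N))] (incidenceComponent N N) := by
  have : incidenceComponent N N = ⋂ n, {p | normalForm p.2 0 * normalForm p.2 n -
      normalForm p.1 (Fin.last N) * conj (normalForm p.1 n.rev) = 0} := by
    ext p
    simp only [mem_incidenceComponent_self_iff, Set.mem_iInter, Set.mem_ofPred_eq, sub_eq_zero]
    constructor
    · intro h n
      rw [h, normalForm_reflectClass_zero, norm_mul_normalForm_reflectClass]
    · intro h
      obtain ⟨r, hr, h0⟩ := exists_normalForm_zero_eq p.2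
      rw [h0] at h
      exact normalForm_injective (eq_normalForm_reflectClass hr (by rw [h0, Complex.ofReal_re]) h)
  rw [this]
  exact @isClosed_iInter _ _ (zariskiTopology pairCoord) _ fun n =>
    (((isRegularFun_normalForm_snd 0).mul (isRegularFun_normalForm_snd n)).sub
      ((isRegularFun_normalForm_fst _).mul
        (isRegularFun_normalForm_fst n.rev).conjugate)).isClosed_zero

theorem not_incidenceComponent_subset_trivial {N k : ℕ} (h0 : 0 < k) (hk : k < N) :
    ¬ incidenceComponent N k ⊆ incidenceComponent N 0 ∪ incidenceComponent N N := by
  obtain ⟨S, rfl⟩ := exists_card_eq_of_le hk.le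
  intro h
  have hinj := rootClass_flipRoots_genericRoots_injective N
  rcases h (pairOfRoots_mem_incidenceComponent S (genericRoots N)) with h | h
  · rw [mem_incidenceComponent_zero_iff] at h
    have : S = ∅ := hinj (by simpa [pairOfRoots, flipRoots_empty] using h)
    simp [this] at h0
  · rw [mem_incidenceComponent_self_iff] at h
    have : S = Finset.univ := hinj (by simpa [pairOfRoots, reflectClass_rootClass] using h)
    simp [this] at hk

/-! ### The structure of the incidence set -/

theorem mainTheorem1 (N : ℕ) :
    -- (i) decomposition of the real algebraic set `I` into irreducible, connected pieces
    (IsClosed[zariskiTopology (pairCoord (N := N))] (incidence N) ∧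
      incidence N = ⋃ k : Fin (N + 1), incidenceComponent N k ∧
      (∀ k ≤ N,
        IsClosed (incidenceComponent N k) ∧
        IsConnected (incidenceComponent N k) ∧
        @IsIrreducible _ (zariskiTopology pairCoord) (incidenceComponent N k)) ∧
      -- the Zariski closures of the pieces in `I` are the irreducible components, without repetition
      Function.Injective (fun k : Fin (N + 1) =>
        closure[zariskiTopology fun p : incidence N => pairCoord p.1]
          {p : incidence N | p.1 ∈ incidenceComponent N k}) ∧
      @irreducibleComponents (incidence N) (zariskiTopology fun p : incidence N => pairCoord p.1) =
        Set.range (fun k : Fin (N + 1) =>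
          closure[zariskiTopology fun p : incidence N => pairCoord p.1]
            {p : incidence N | p.1 ∈ incidenceComponent N k})) ∧
    -- (ii) each piece is a finite cover
    (∀ k ≤ N,
      IsFiniteCover (firstProj (incidenceComponent N k)) ∧
      coverDegree (firstProj (incidenceComponent N k)) = (N.choose k : ℕ∞)) ∧
    -- (iii) total degree, and the two pieces isomorphic to the space of signals
    (IsFiniteCover (firstProj (incidence N)) ∧
      coverDegree (firstProj (incidence N)) =
        ∑ k ∈ Finset.range (N + 1), (N.choose k : ℕ∞) ∧
      coverDegree (firstProj (incidence N)) = 2 ^ N ∧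
      SemialgebraicallyIsomorphic (classCoord (N := N))
        (fun p : incidenceComponent N 0 => pairCoord p.1) ∧
      SemialgebraicallyIsomorphic (classCoord (N := N))
        (fun p : incidenceComponent N N => pairCoord p.1)) ∧
    -- (iv) the additional action of the group of order two
    (Function.Involutive (reflectSecond (N := N)) ∧
      Continuous (reflectSecond (N := N)) ∧
      Set.MapsTo reflectSecond (incidence N) (incidence N) ∧
      ∀ k ≤ N, reflectSecond '' incidenceComponent N k = incidenceComponent N (N - k)) ∧
    -- (v) pairs outside `I_0 ∪ I_N`, and generic pairs of the other pieces, are non-trivial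
    ((∀ k ≤ N, ∀ p ∈ incidenceComponent N k \ (incidenceComponent N 0 ∪ incidenceComponent N N),
        ¬ IsTrivialAmbiguity p.1 p.2) ∧
      ∀ k, 0 < k → k < N →
        ∃ Z : Set (SignalClass N × SignalClass N),
          IsClosed[zariskiTopology pairCoord] Z ∧
          ¬ incidenceComponent N k ⊆ Z ∧
          ∀ p ∈ incidenceComponent N k \ Z, ¬ IsTrivialAmbiguity p.1 p.2) := by
  have hcard : ∀ k, (Finset.powersetCard k (Finset.univ : Finset (Fin N))).card = N.choose k :=
    fun k => by rw [Finset.card_powersetCard, Finset.card_univ, Fintype.card_fin]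
  have hne : ∀ k ≤ N, (Finset.powersetCard k (Finset.univ : Finset (Fin N))).Nonempty :=
    fun k hk => by
      rw [← Finset.card_pos, hcard]
      exact Nat.choose_pos hk
  have hdeg : coverDegree (firstProj (incidence N)) = 2 ^ N := by
    rw [(isFlipSet_incidence N).coverDegree_eq]
    simp
  have hle : ∀ k : Fin (N + 1), (k : ℕ) ≤ N := fun k => Nat.lt_succ_iff.1 k.2
  refine ⟨⟨isClosed_incidence N, incidence_eq_iUnion N, fun k hk => ⟨?_, ?_, ?_⟩, ?_, ?_⟩,
    fun k hk => ⟨?_, ?_⟩, ⟨?_, ?_, hdeg, ?_, ?_⟩,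
    ⟨reflectSecond_involutive, continuous_reflectSecond, fun _ => reflectSecond_mem_incidence,
      fun k hk => image_reflectSecond_incidenceComponent hk⟩, fun k _ p hp hp' => ?_,
    fun k h0 hk => ?_⟩
  · exact (isFlipSet_incidenceComponent N k).isClosed
  · exact (isFlipSet_incidenceComponent N k).isConnected (hne k hk)
  · exact isIrreducible_incidenceComponent hk
  · intro j k hjk
    refine Fin.ext (eq_of_incidenceComponent_subset_closure (hle j) (hle k) ?_)
    exact (@subset_closure _ (zariskiTopology fun p : incidence N => pairCoord p.1) _).trans
      hjk.subset
  · refine @irreducibleComponents_eq_range_closure _ _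
      (zariskiTopology fun p : incidence N => pairCoord p.1) _ _
      (fun k => isIrreducible_incidenceComponent_subtype (hle k)) ?_
      fun j k hjk => Fin.ext (eq_of_incidenceComponent_subset_closure (hle j) (hle k) hjk)
    refine Set.eq_univ_of_forall fun p => ?_
    obtain ⟨k, hk⟩ := Set.mem_iUnion.1 ((incidence_eq_iUnion N).subset p.2)
    exact Set.mem_iUnion.2 ⟨k, hk⟩
  · exact (isFlipSet_incidenceComponent N k).isFiniteCover (hne k hk)
  · rw [(isFlipSet_incidenceComponent N k).coverDegree_eq, hcard]
  · exact (isFlipSet_incidence N).isFiniteCover Finset.univ_nonempty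
  · rw [hdeg, ← Nat.cast_sum, Nat.sum_range_choose]
    simp
  · exact semialgebraicallyIsomorphic_incidenceComponent_zero N
  · exact semialgebraicallyIsomorphic_incidenceComponent_self N
  · exact hp.2 (isTrivialAmbiguity_iff.1 hp')
  · exact ⟨_, @IsClosed.union _ _ _ (zariskiTopology pairCoord)
      (isClosed_incidenceComponent_zero N) (isClosed_incidenceComponent_self N),
      not_incidenceComponent_subset_trivial h0 hk, fun p hp hp' =>
        hp.2 (isTrivialAmbiguity_iff.1 hp')⟩
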